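/- **Setting.** Consider $w''(z)-\{u^{2}f(z)+g(z)\}w(z)=p(z)$ with a complex parameter $u$, where $f,g$ are meromorphic and $p$ is analytic in a domain $Z\subseteq\mathbb{C}$, and $f$ has no zero in $Z$ except a simple zero (turning point) at $z_0\in Z$. Let $D\subseteq Z\setminus\{z_0\}$ be open and simply connected (for example $Z$ with branch cuts removed), free of poles of $f$ and $g$, on which there are analytic branches of $f^{1/4}$ and of $$\xi(z)=\int_{z_0}^{z}f^{1/2}(t)\,dt ,$$ the latter injective on $D$, with inverse $z(\xi)$ on $\Xi=\xi(D)$. Put $$\Phi=\frac{4ff''-5f'^2}{16f^3}+\frac gf,\qquad \psi(\xi)=\Phi(z(\xi)),$$ $$G_0(\xi)=-f^{-3/4}(z)\,p(z)\big|_{z=z(\xi)},\qquad G_{s+1}(\xi)=G_s''(\xi)-\psi(\xi)G_s(\xi)\quad(s=0,1,2,\dots).$$ Let $\mathcal L$ be a progressive path in $\Xi$: a continuous path without endpoints that is a finite chain of twice continuously differentiable arcs with non-vanishing derivative, along which $\Re(ut)$ is monotonic and runs from $-\infty$ (at the reference point $\xi^{(j)}$) to $+\infty$ (at the reference point $\xi^{(k)}$).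 Fix an integer $n\ge 0$, assume that $\int_{\mathcal L}|\psi(t)\,dt|$, $\int_{\mathcal L}|G_n'(t)\,dt|$, $\int_{\mathcal L}|G_n''(t)\,dt|$ and $\sup_{t\in\mathcal L}|G_n(t)|$ are finite, and put $$L_n=\sup_{t\in\mathcal L}|G_n(t)|+\frac12\int_{\mathcal L}|G_n'(t)\,dt| .$$ **Theorem.** Suppose that $|u|>\frac12\int_{\mathcal L}|\psi(t)\,dt|$. For a solution $w$ of the equation that is analytic in $D$, define the error term $\varepsilon_n(u,\xi)$ $(\xi\in\Xi)$ by $$w(z(\xi))=\frac1{f^{1/4}(z(\xi))}\left[\frac1{u^2}\sum_{s=0}^{n-1}\frac{G_s(\xi)}{u^{2s}}+\varepsilon_n(u,\xi)\right].$$ Then there is a unique such solution $w$ whose error term is bounded on $\mathcal L$. Its error term satisfies, for every $\xi\in\mathcal L$, $$|\varepsilon_n(u,\xi)|\le\frac1{|u|^{2n+2}}\left\{|G_n(\xi)|+\frac12\int_{\mathcal L}|G_n'(t)\,dt|\right\}+\frac{L_n}{2|u|^{2n+3}}\left\{1-\frac1{2|u|}\int_{\mathcal L}|\psi(t)\,dt|\right\}^{-1}\int_{\mathcal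 L}|\psi(t)\,dt| ,$$ and it is differentiable there with $$\left|\frac{\partial\varepsilon_n(u,\xi)}{\partial\xi}\right|\le\frac1{|u|^{2n+2}}\left[|G_n'(\xi)|+\frac12\int_{\mathcal L}|G_n''(t)\,dt|+\frac12L_n\left\{1-\frac1{2|u|}\int_{\mathcal L}|\psi(t)\,dt|\right\}^{-1}\int_{\mathcal L}|\psi(t)\,dt|\right].$$ -/

import Mathlib

open Set Filter Topology MeasureTheory

noncomputable section

/-- The equation `w'' - (u² f + g) w = p` on a domain `Z`: `f` and `g` are meromorphic and `p` is
analytic on `Z`, and `f` has no zero in `Z` except for a simple zero at the turning point `z₀`. -/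
structure IsTurningPointEquation (Z : Set ℂ) (z₀ : ℂ) (f g p : ℂ → ℂ) : Prop where
  isOpen : IsOpen Z
  isPreconnected : IsPreconnected Z
  mem : z₀ ∈ Z
  meromorphic_f : MeromorphicOn f Z
  meromorphic_g : MeromorphicOn g Z
  analytic_p : AnalyticOnNhd ℂ p Z
  simple_zero : meromorphicOrderAt f z₀ = 1
  no_other_zero : ∀ z ∈ Z, z ≠ z₀ → meromorphicOrderAt f z ≤ 0

/-- `D` is a simply connected open part of `Z` (for instance `Z` with branch cuts removed) that
contains neither the turning point nor a pole of `f` or `g`; on `D` the function `ξ` is a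
single-valued, injective branch of `∫_{z₀}^z f^{1/2}(t) dt` (a primitive of a square root of `f`
which tends to `0` along some path in `D` issuing from `z₀`), and `q` is a branch of `f^{1/4}`. -/
structure IsLiouvilleBranch (Z : Set ℂ) (z₀ : ℂ) (f g : ℂ → ℂ) (D : Set ℂ) (ξ q : ℂ → ℂ) :
    Prop where
  isOpen : IsOpen D
  isSimplyConnected : IsSimplyConnected D
  subset : D ⊆ Z \ {z₀}
  analytic_f : AnalyticOnNhd ℂ f D
  analytic_g : AnalyticOnNhd ℂ g D
  differentiableOn_xi : DifferentiableOn ℂ ξ D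
  deriv_xi_sq : ∀ z ∈ D, (deriv ξ z) ^ 2 = f z
  xi_base : ∃ c : ℝ → ℂ, ContinuousOn c (Icc 0 1) ∧ c 0 = z₀ ∧ (∀ s ∈ Ioc (0 : ℝ) 1, c s ∈ D) ∧
    Tendsto (fun s => ξ (c s)) (𝓝[>] 0) (𝓝 0)
  injOn_xi : InjOn ξ D
  differentiableOn_q : DifferentiableOn ℂ q D
  q_pow_four : ∀ z ∈ D, q z ^ 4 = f z

/-- The inverse `z(ξ)` of the change of variable, defined on the image of `D` under `ξ`. -/
def zOfXi (D : Set ℂ) (ξ : ℂ → ℂ) : ℂ → ℂ := Function.invFunOn ξ D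

/-- The function `Φ(z) = (4 f f'' - 5 f'²) / (16 f³) + g / f`. -/
def lgPhi (f g : ℂ → ℂ) (z : ℂ) : ℂ :=
  (4 * f z * deriv (deriv f) z - 5 * (deriv f z) ^ 2) / (16 * f z ^ 3) + g z / f z

/-- The function `ψ(ξ) = Φ(z(ξ))`. -/
def lgPsi (f g : ℂ → ℂ) (D : Set ℂ) (ξ : ℂ → ℂ) (t : ℂ) : ℂ := lgPhi f g (zOfXi D ξ t)

/-- The coefficients: `G₀ = -f^{-3/4} p` (as a function of `ξ`) and `G_{s+1} = G_s'' - ψ G_s`. -/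
def lgCoeff (f g p : ℂ → ℂ) (D : Set ℂ) (ξ q : ℂ → ℂ) : ℕ → ℂ → ℂ
  | 0 => fun t => -(p (zOfXi D ξ t) / q (zOfXi D ξ t) ^ 3)
  | s + 1 => fun t => deriv (deriv (lgCoeff f g p D ξ q s)) t
      - lgPsi f g D ξ t * lgCoeff f g p D ξ q s t

/-- `w` is an analytic solution of `w'' - (u² f + g) w = p` in `D`. -/
def IsParticularSolution (f g p : ℂ → ℂ) (u : ℂ) (D : Set ℂ) (w : ℂ → ℂ) : Prop :=
  DifferentiableOn ℂ w D ∧ ∀ z ∈ D, deriv (deriv w) z - (u ^ 2 * f z + g z) * w z = p z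

/-- The error term `ε_n(u, ξ)` of a solution `w`, that is, the function with
`w(z(ξ)) = f^{-1/4}(z(ξ)) [u⁻² ∑_{s < n} G_s(ξ) u^{-2s} + ε_n(u, ξ)]`. -/
def lgError (f g p : ℂ → ℂ) (D : Set ℂ) (ξ q : ℂ → ℂ) (u : ℂ) (n : ℕ) (w : ℂ → ℂ) (t : ℂ) : ℂ :=
  q (zOfXi D ξ t) * w (zOfXi D ξ t)
    - 1 / u ^ 2 * ∑ s ∈ Finset.range n, lgCoeff f g p D ξ q s t / u ^ (2 * s)

/-- An `R₂` path without endpoints: a continuous path consisting of a finite chain of arcs that are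
twice continuously differentiable with nonvanishing derivative. The finite set `S` holds the
parameters of the junctions; on every compact parameter interval without a junction in its interior
the path is regular, with one-sided derivatives at the ends. -/
def IsR2Path (γ : ℝ → ℂ) : Prop :=
  Continuous γ ∧ ∃ S : Finset ℝ, ∀ a b : ℝ, a < b → Disjoint (Ioo a b) (S : Set ℝ) →
    ContDiffOn ℝ 2 γ (Icc a b) ∧ ∀ s ∈ Icc a b, derivWithin γ (Icc a b) s ≠ 0

/-- `γ` is a progressive path in `Ξ`: an `R₂` path along which `Re(u t)` is monotonic and runs from
`-∞` (at the reference point `ξ^{(j)}`) to `+∞` (at the reference point `ξ^{(k)}`). -/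
structure IsProgressivePath (u : ℂ) (Ξ : Set ℂ) (γ : ℝ → ℂ) : Prop where
  isR2Path : IsR2Path γ
  mem : ∀ s, γ s ∈ Ξ
  monotone : Monotone fun s => (u * γ s).re
  tendsto_atBot : Tendsto (fun s => (u * γ s).re) atBot atBot
  tendsto_atTop : Tendsto (fun s => (u * γ s).re) atTop atTop

/-- The integral `∫_γ |h(t) dt|` exists. -/
def PathIntegrable (γ : ℝ → ℂ) (h : ℂ → ℂ) : Prop :=
  Integrable (fun s : ℝ => ‖h (γ s)‖ * ‖deriv γ s‖)

/-- The integral `∫_γ |h(t) dt|`. -/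
def pathIntegral (γ : ℝ → ℂ) (h : ℂ → ℂ) : ℝ := ∫ s : ℝ, ‖h (γ s)‖ * ‖deriv γ s‖

/-- `sup_{t ∈ γ} |h(t)| + ½ ∫_γ |h'(t) dt|`; for `h = G_n` this is the quantity `L_n`. -/
def lgL (γ : ℝ → ℂ) (h : ℂ → ℂ) : ℝ := (⨆ s : ℝ, ‖h (γ s)‖) + 1 / 2 * pathIntegral γ (deriv h)

end

noncomputable section

/-! In the variable ξ, the function W = f^{1/4} w satisfies W'' = (u² + ψ) W - G₀. Each term of the
series in u⁻² that is subtracted from W cancels the current inhomogeneity and leaves the next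
coefficient, so ε_n satisfies ε'' = (u² + ψ) ε - G_n / u^{2n} (`deriv_deriv_lgError`).

Along the path, d²/dξ² - u² is inverted by integrating e^{-u(ξ-t)} over the part before ξ and
e^{u(ξ-t)} over the part after it. Monotonicity of Re(ut) bounds both kernels by 1, so variation of
parameters gives a fixed point equation whose linear part has norm at most ∫|ψ|/(2|u|) < 1
(`exists_bounded_fixedPoint`). One integration by parts gives the free term its factor u⁻² and
brings in G_n'; a second one does the same for its derivative and brings in G_n''
(`exists_solution_with_bounds`). A bounded homogeneous solution vanishes: each of e^{±uξ} blows up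
at one end of the path, and smallness of the kernel removes what remains (`eq_zero_of_bounded`).

This yields a function on the path only. On the simply connected D there is a holomorphic solution
with any prescribed initial data (`exists_isParticularSolution`); the one with the data of the path
solution at one point agrees with it along the whole path, by constancy of Wronskians
(`eq_zero_of_initial`). Uniqueness passes from the path to D by the identity theorem. -/

/-! ### Linear differential equations on simply connected domains -/

/-- On a simply connected, locally path connected space, a locally constant additive cocycle
`F a - F b` on an open cover `U` is the coboundary of a locally constant cochain. -/
theorem exists_eventually_eq_of_locallyConstant_cocycle {X V : Type*} [TopologicalSpace X]
    [SimplyConnectedSpace X] [LocallyPathConnectedSpace X] [AddCommGroup V]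
    (U : X → Set X) (hUo : ∀ a, IsOpen (U a)) (hUa : ∀ a, a ∈ U a) (F : X → X → V)
    (hF : ∀ a b, ∀ x ∈ U a ∩ U b, ∀ᶠ y in 𝓝 x, F a y - F b y = F a x - F b x) :
    ∃ c : X → V, ∀ a, ∀ᶠ x in 𝓝 a, c x + (F x x - F a x) = c a := by
  classical
  let tV : TopologicalSpace V := ⊥
  have dV : DiscreteTopology V := ⟨rfl⟩
  -- The cocycle glues copies of `U a × V`, with `V` discrete, into a covering space of `X`. Simple
  -- connectedness gives it a global section, and `c` is the fibre coordinate of that section.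
  let core : FiberBundleCore X X V :=
    { baseSet := U
      isOpen_baseSet := hUo
      indexAt := id
      mem_baseSet_at := hUa
      coordChange := fun a b x v => v + (F a x - F b x)
      coordChange_self := fun a x _ v => by simp
      continuousOn_coordChange := by
        intro a b
        rintro ⟨x, v⟩ ⟨hx, -⟩
        apply ContinuousAt.continuousWithinAt
        refine tendsto_nhds_of_eventually_eq ?_
        rw [nhds_prod_eq, nhds_discrete V]
        filter_upwards [(hF a b x hx).prod_mk (show ∀ᶠ w in pure v, w = v by simp)] with p hp
        simp [hp.1, hp.2]
      coordChange_comp := fun a b c x _ v => by abel }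
  have hcov : IsCoveringMap core.proj := FiberBundle.isCoveringMap (F := V) (E := core.Fiber)
  obtain ⟨x₀⟩ : Nonempty X := inferInstance
  obtain ⟨s, ⟨-, hs⟩, -⟩ := hcov.existsUnique_continuousMap_lifts (ContinuousMap.id X) x₀
    (⟨x₀, (0 : V)⟩ : core.TotalSpace) rfl
  have hs1 : ∀ x : X, (s x).proj = x := fun x => congrFun hs x
  let c : X → V := fun x => (s x).2
  refine ⟨c, fun a => ?_⟩
  -- Read in the fixed chart at `a`, the section is a continuous map to a discrete space, hence
  -- constant near `a`.
  have hcont : ContinuousAt (fun x => core.localTriv a (s x)) a := by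
    refine ContinuousAt.comp (f := s) (g := core.localTriv a) ?_ s.continuous.continuousAt
    refine (core.localTriv a).continuousAt ?_
    rw [FiberBundleCore.mem_localTriv_source, hs1]
    exact hUa a
  have h3 := hcont.snd.tendsto
  rw [nhds_discrete V, tendsto_pure] at h3
  filter_upwards [h3] with x hx
  have e : ∀ x, (core.localTriv a (s x)).2 = c x + (F x x - F a x) := by
    intro x
    change c x + (F (s x).proj (s x).proj - F a (s x).proj) = _
    rw [hs1]
  rw [e, e] at hx
  simpa using hx

/-- On a simply connected open set every holomorphic function has a primitive. -/
theorem exists_primitive_of_isSimplyConnected {E : Type*} [NormedAddCommGroup E]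
    [NormedSpace ℂ E] [CompleteSpace E] {D : Set ℂ} (hDo : IsOpen D) (hDc : IsSimplyConnected D)
    {h : ℂ → E} (hh : DifferentiableOn ℂ h D) :
    ∃ H : ℂ → E, ∀ z ∈ D, HasDerivAt H (h z) z := by
  classical
  have hball : ∀ a : D, ∃ r > 0, Metric.ball (a : ℂ) r ⊆ D := fun a =>
    Metric.isOpen_iff.1 hDo a a.2
  choose r hr0 hrD using hball
  have hprim : ∀ a : D, ∃ F : ℂ → E, ∀ z ∈ Metric.ball (a : ℂ) (r a), HasDerivAt F (h z) z :=
    fun a => (hh.mono (hrD a)).isExactOn_ball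
  choose F hF using hprim
  have hconst : ∀ (a b : D) (x : ℂ), x ∈ Metric.ball (a : ℂ) (r a) →
      x ∈ Metric.ball (b : ℂ) (r b) → ∀ᶠ y in 𝓝 x, F a y - F b y = F a x - F b x := by
    intro a b x ha hb
    have hconv : Convex ℝ (Metric.ball (a : ℂ) (r a) ∩ Metric.ball (b : ℂ) (r b)) :=
      (convex_ball _ _).inter (convex_ball _ _)
    have hop : IsOpen (Metric.ball (a : ℂ) (r a) ∩ Metric.ball (b : ℂ) (r b)) :=
      Metric.isOpen_ball.inter Metric.isOpen_ball
    filter_upwards [hop.mem_nhds ⟨ha, hb⟩] with y hy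
    have hd : ∀ z ∈ Metric.ball (a : ℂ) (r a) ∩ Metric.ball (b : ℂ) (r b),
        HasDerivWithinAt (F a - F b) 0
          (Metric.ball (a : ℂ) (r a) ∩ Metric.ball (b : ℂ) (r b)) z := by
      intro z hz
      simpa using ((hF a z hz.1).sub (hF b z hz.2)).hasDerivWithinAt
    have := hconv.norm_image_sub_le_of_norm_hasDerivWithin_le (C := 0) hd (by simp)
      ⟨ha, hb⟩ hy
    simpa [sub_eq_zero] using this
  have := hDc.simplyConnectedSpace
  have := hDo.locallyPathConnectedSpace
  obtain ⟨c, hc⟩ := exists_eventually_eq_of_locallyConstant_cocycle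
    (fun a : D => {x : D | (x : ℂ) ∈ Metric.ball (a : ℂ) (r a)})
    (fun a => Metric.isOpen_ball.preimage continuous_subtype_val)
    (fun a => Metric.mem_ball_self (hr0 a)) (fun a x => F a x)
    (fun a b x hx => continuous_subtype_val.continuousAt.eventually (hconst a b x hx.1 hx.2))
  -- The constants `c` correct the local primitives so that near `z` the glued function is `c z + F
  -- z`, with the chart frozen at `z`.
  refine ⟨fun z => if hz : z ∈ D then c ⟨z, hz⟩ + F ⟨z, hz⟩ z else 0, fun z hz => ?_⟩
  have hd : HasDerivAt (fun y => c ⟨z, hz⟩ + F ⟨z, hz⟩ y) (h z) z :=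
    (hF ⟨z, hz⟩ z (Metric.mem_ball_self (hr0 _))).const_add _
  refine hd.congr_of_eventuallyEq ?_
  have h4 := hc ⟨z, hz⟩
  rw [nhds_subtype_eq_comap, eventually_comap] at h4
  filter_upwards [h4, hDo.mem_nhds hz] with y hy hyD
  have := hy ⟨y, hyD⟩ rfl
  simp only [hyD, dif_pos]
  rw [← this]
  abel

/-- A nonnegative sequence with `u (k + 1) ≤ a k + u k / 2`, `a` summable, is summable. -/
theorem summable_of_le_add_half {u a : ℕ → ℝ} (hu : ∀ k, 0 ≤ u k) (ha : Summable a)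
    (ha0 : ∀ k, 0 ≤ a k) (h : ∀ k, u (k + 1) ≤ a k + u k / 2) : Summable u := by
  refine summable_of_sum_range_le (c := 2 * (u 0 + ∑' k, a k)) hu fun n => ?_
  induction n with
  | zero =>
    have : 0 ≤ ∑' k, a k := tsum_nonneg ha0
    have := hu 0
    simp; linarith
  | succ n ih =>
    rw [Finset.sum_range_succ']
    have h1 : ∑ k ∈ Finset.range n, u (k + 1) ≤ ∑ k ∈ Finset.range n, (a k + u k / 2) :=
      Finset.sum_le_sum fun k _ => h k
    rw [Finset.sum_add_distrib, ← Finset.sum_div] at h1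
    have h2 := ha.sum_le_tsum (Finset.range n) (fun k _ => ha0 k)
    linarith

/-- The Picard iterates of a linear equation with summable norms at one point have norms that are
summable uniformly on a whole small ball. -/
theorem exists_ball_summable_of_picard {E : Type*} [NormedAddCommGroup E] [NormedSpace ℂ E]
    {D : Set ℂ} (hDo : IsOpen D) {M : ℂ → E →L[ℂ] E} (hM : ContinuousOn M D) {Y : ℕ → ℂ → E}
    (hY0 : ContinuousOn (Y 0) D) (hY : ∀ k, ∀ z ∈ D, HasDerivAt (Y (k + 1)) (M z (Y k z)) z)
    {z : ℂ} (hz : z ∈ D) :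
    ∃ r > 0, Metric.ball z r ⊆ D ∧ ∀ x ∈ Metric.ball z r, Summable (fun k => ‖Y k x‖) →
      ∃ b : ℕ → ℝ, Summable b ∧ ∀ k, ∀ y ∈ Metric.ball z r, ‖Y k y‖ ≤ b k := by
  have hMc := (hM.continuousAt (hDo.mem_nhds hz)).norm
  have hYc := (hY0.continuousAt (hDo.mem_nhds hz)).norm
  have e1 : ∀ᶠ x in 𝓝 z, ‖M x‖ < ‖M z‖ + 1 := hMc.eventually_lt_const (by linarith)
  have e2 : ∀ᶠ x in 𝓝 z, ‖Y 0 x‖ < ‖Y 0 z‖ + 1 := hYc.eventually_lt_const (by linarith)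
  obtain ⟨r₁, hr₁, hr₁'⟩ := Metric.eventually_nhds_iff_ball.1
    ((e1.and e2).and (hDo.mem_nhds hz))
  set C := ‖M z‖ + 1 with hC
  have hC0 : 0 < C := by positivity
  -- Two points of the ball are less than `2 * r` apart, so integrating `M` between them costs a
  -- factor at most `C * (2 * r) ≤ 1 / 2`.
  set r := min r₁ (1 / (4 * C)) with hr
  have hr0 : 0 < r := lt_min hr₁ (by positivity)
  have hrr : Metric.ball z r ⊆ Metric.ball z r₁ := Metric.ball_subset_ball (min_le_left _ _)
  have hrC : C * (2 * r) ≤ 1 / 2 := by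
    have : r ≤ 1 / (4 * C) := min_le_right _ _
    calc C * (2 * r) ≤ C * (2 * (1 / (4 * C))) := by gcongr
      _ = 1 / 2 := by field_simp; norm_num
  refine ⟨r, hr0, fun x hx => (hr₁' x (hrr hx)).2, fun x hx hsum => ?_⟩
  -- Value of the iterate at the reference point `x` plus its variation over the ball, at most half
  -- the previous bound.
  let b : ℕ → ℝ := fun k => Nat.rec (‖Y 0 z‖ + 1) (fun k v => ‖Y (k + 1) x‖ + v / 2) k
  have hb0 : ∀ k, 0 ≤ b k := by
    intro k
    induction k with
    | zero => change 0 ≤ ‖Y 0 z‖ + 1; positivity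
    | succ k ih => change 0 ≤ ‖Y (k + 1) x‖ + b k / 2; positivity
  refine ⟨b, summable_of_le_add_half hb0 ((summable_nat_add_iff 1).2 hsum)
    (fun k => norm_nonneg _) (fun k => le_rfl), fun k => ?_⟩
  induction k with
  | zero => exact fun y hy => (hr₁' y (hrr hy)).1.2.le
  | succ k ih =>
    intro y hy
    have hd : ‖Y (k + 1) y - Y (k + 1) x‖ ≤ C * b k * ‖y - x‖ := by
      refine (convex_ball z r).norm_image_sub_le_of_norm_hasDerivWithin_le
        (f' := fun w => M w (Y k w))
        (fun w hw => (hY k w (hr₁' w (hrr hw)).2).hasDerivWithinAt) (fun w hw => ?_) hx hy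
      refine ((M w).le_opNorm _).trans ?_
      exact mul_le_mul (hr₁' w (hrr hw)).1.1.le (ih w hw) (norm_nonneg _) hC0.le
    have hyx : ‖y - x‖ ≤ 2 * r := by
      rw [← dist_eq_norm]
      have := dist_triangle_right y x z
      rw [Metric.mem_ball] at hx hy
      linarith
    have h1 : C * b k * ‖y - x‖ ≤ b k / 2 := by
      calc C * b k * ‖y - x‖ ≤ C * b k * (2 * r) := by
            gcongr; exact mul_nonneg hC0.le (hb0 k)
        _ = b k * (C * (2 * r)) := by ring
        _ ≤ b k * (1 / 2) := by gcongr; exact hb0 k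
        _ = b k / 2 := by ring
    have h2 : ‖Y (k + 1) y‖ ≤ ‖Y (k + 1) x‖ + ‖Y (k + 1) y - Y (k + 1) x‖ := by
      simpa using norm_add_le (Y (k + 1) x) (Y (k + 1) y - Y (k + 1) x)
    change _ ≤ ‖Y (k + 1) x‖ + b k / 2
    linarith

/-- The initial value problem for a linear differential equation with holomorphic coefficients on
a simply connected domain has a global solution. -/
theorem exists_hasDerivAt_linear {E : Type*} [NormedAddCommGroup E] [NormedSpace ℂ E]
    [CompleteSpace E] {D : Set ℂ} (hDo : IsOpen D) (hDc : IsSimplyConnected D)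
    {M : ℂ → E →L[ℂ] E} (hM : DifferentiableOn ℂ M D) {H : ℂ → E} (hH : DifferentiableOn ℂ H D)
    {z₁ : ℂ} (hz₁ : z₁ ∈ D) (c : E) :
    ∃ Y : ℂ → E, Y z₁ = c ∧ ∀ z ∈ D, HasDerivAt Y (M z (Y z) + H z) z := by
  -- The holomorphy assumption sits inside the existential so that the chosen `P` is total and the
  -- iterates can be defined before they are known to be holomorphic.
  have hprim : ∀ (h : ℂ → E) (v : E), ∃ F : ℂ → E, DifferentiableOn ℂ h D →
      F z₁ = v ∧ ∀ z ∈ D, HasDerivAt F (h z) z := by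
    intro h v
    by_cases hh : DifferentiableOn ℂ h D
    · obtain ⟨F, hF⟩ := exists_primitive_of_isSimplyConnected hDo hDc hh
      obtain ⟨G, hG⟩ := Complex.IsExactOn.with_val_at ⟨F, hF⟩ z₁ v
      exact ⟨G, fun _ => hG⟩
    · exact ⟨h, fun h' => absurd h' hh⟩
  choose P hP using hprim
  let Y : ℕ → ℂ → E := fun k => Nat.rec (P H c) (fun _ y => P (fun z => M z (y z)) 0) k
  have hYd : ∀ k, DifferentiableOn ℂ (Y k) D := by
    intro k
    induction k with
    | zero => exact fun z hz => ((hP H c hH).2 z hz).differentiableAt.differentiableWithinAt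
    | succ k ih =>
      exact fun z hz => ((hP _ 0 (hM.clm_apply ih)).2 z hz).differentiableAt.differentiableWithinAt
  have hY0 : ∀ z ∈ D, HasDerivAt (Y 0) (H z) z := (hP H c hH).2
  have hY : ∀ k, ∀ z ∈ D, HasDerivAt (Y (k + 1)) (M z (Y k z)) z := fun k =>
    (hP _ 0 (hM.clm_apply (hYd k))).2
  have hY1 : ∀ k, Y (k + 1) z₁ = 0 := fun k => (hP _ 0 (hM.clm_apply (hYd k))).1
  have hball := fun z (hz : z ∈ D) =>
    exists_ball_summable_of_picard hDo hM.continuousOn (hYd 0).continuousOn hY hz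
  have hsum : ∀ z ∈ D, Summable fun k => ‖Y k z‖ := by
    -- The radius of each ball does not depend on the point where summability is known, so the
    -- summability set is open and relatively closed in `D`; it contains `z₁`, where all iterates
    -- but the first vanish.
    have hsub : D ⊆ {z | z ∈ D ∧ Summable fun k => ‖Y k z‖} := by
      refine hDc.isPathConnected.isConnected.isPreconnected.subset_of_closure_inter_subset
        ?_ ⟨z₁, hz₁, hz₁, ?_⟩ ?_
      · rw [isOpen_iff_mem_nhds]
        rintro z ⟨hz, hs⟩
        obtain ⟨r, hr, hrD, h⟩ := hball z hz
        obtain ⟨b, hb, hbY⟩ := h z (Metric.mem_ball_self hr) hs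
        filter_upwards [Metric.ball_mem_nhds z hr] with y hy
        exact ⟨hrD hy, Summable.of_nonneg_of_le (fun _ => norm_nonneg _) (fun k => hbY k y hy) hb⟩
      · rw [← summable_nat_add_iff 1]
        simp [hY1]
      · rintro z ⟨hzc, hz⟩
        obtain ⟨r, hr, hrD, h⟩ := hball z hz
        obtain ⟨x, hx, hx'⟩ := mem_closure_iff_nhds.1 hzc _ (Metric.ball_mem_nhds z hr)
        obtain ⟨b, hb, hbY⟩ := h x hx hx'.2
        exact ⟨hz, Summable.of_nonneg_of_le (fun _ => norm_nonneg _)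
          (fun k => hbY k z (Metric.mem_ball_self hr)) hb⟩
    exact fun z hz => (hsub hz).2
  refine ⟨fun z => ∑' k, Y k z, ?_, fun z hz => ?_⟩
  · have hs := (hsum z₁ hz₁).of_norm
    change ∑' k, Y k z₁ = c
    rw [hs.tsum_eq_zero_add]
    simp only [hY1, tsum_zero, add_zero]
    exact (hP H c hH).1
  · obtain ⟨r, hr, hrD, h⟩ := hball z hz
    obtain ⟨b, hb, hbY⟩ := h z (Metric.mem_ball_self hr) (hsum z hz)
    have hzr := Metric.mem_ball_self (x := z) hr
    have hd := Complex.hasSum_deriv_of_summable_norm hb (fun k => (hYd k).mono hrD)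
      Metric.isOpen_ball hbY hzr
    have hdiff := Complex.differentiableOn_tsum_of_summable_norm hb (fun k => (hYd k).mono hrD)
      Metric.isOpen_ball hbY
    have hda := (hdiff.differentiableAt (Metric.isOpen_ball.mem_nhds hzr)).hasDerivAt
    convert hda using 1
    -- Termwise differentiation: the zeroth term gives `H z`, and the shifted tail reassembles to `M
    -- z` applied to the sum.
    rw [← hd.tsum_eq, hd.summable.tsum_eq_zero_add, (hY0 z hz).deriv, add_comm,
      (M z).map_tsum (hsum z hz).of_norm]
    simp only [fun k => (hY k z hz).deriv]

/-- The initial value problem for `w'' = A w + h` with holomorphic `A`, `h` on a simply connected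
domain has a global solution. -/
theorem exists_deriv_deriv_eq {D : Set ℂ} (hDo : IsOpen D) (hDc : IsSimplyConnected D)
    {A h : ℂ → ℂ} (hA : DifferentiableOn ℂ A D) (hh : DifferentiableOn ℂ h D)
    {z₁ : ℂ} (hz₁ : z₁ ∈ D) (a b : ℂ) :
    ∃ w : ℂ → ℂ, DifferentiableOn ℂ w D ∧ w z₁ = a ∧ deriv w z₁ = b ∧
      ∀ z ∈ D, deriv (deriv w) z = A z * w z + h z := by
  -- Companion system for the pair `(w, w')`: `(x, y) ↦ (y, A z * x)`.
  let M : ℂ → (ℂ × ℂ) →L[ℂ] (ℂ × ℂ) := fun z =>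
    (ContinuousLinearMap.inl ℂ ℂ ℂ).comp (ContinuousLinearMap.snd ℂ ℂ ℂ)
      + A z • (ContinuousLinearMap.inr ℂ ℂ ℂ).comp (ContinuousLinearMap.fst ℂ ℂ ℂ)
  have hM : DifferentiableOn ℂ M D := (hA.smul_const _).const_add _
  have hH : DifferentiableOn ℂ (fun z => ((0 : ℂ), h z)) D :=
    (differentiableOn_const _).prodMk hh
  obtain ⟨Y, hY0, hY⟩ := exists_hasDerivAt_linear hDo hDc hM hH hz₁ (a, b)
  have h1 : ∀ z ∈ D, HasDerivAt (fun z => (Y z).1) (Y z).2 z := fun z hz => by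
    have := (ContinuousLinearMap.fst ℂ ℂ ℂ).hasFDerivAt.comp_hasDerivAt z (hY z hz)
    simpa [M, Function.comp_def] using this
  have h2 : ∀ z ∈ D, HasDerivAt (fun z => (Y z).2) (A z * (Y z).1 + h z) z := fun z hz => by
    have := (ContinuousLinearMap.snd ℂ ℂ ℂ).hasFDerivAt.comp_hasDerivAt z (hY z hz)
    simpa [M, Function.comp_def] using this
  refine ⟨fun z => (Y z).1, fun z hz => (h1 z hz).differentiableAt.differentiableWithinAt,
    by simp [hY0], by rw [(h1 z₁ hz₁).deriv, hY0], fun z hz => ?_⟩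
  have : deriv (fun z => (Y z).1) =ᶠ[𝓝 z] fun z => (Y z).2 := by
    filter_upwards [hDo.mem_nhds hz] with y hy using (h1 y hy).deriv
  rw [this.deriv_eq, (h2 z hz).deriv]

/-! ### Calculus on the real line off a finite set -/

/-- A continuous function whose derivative vanishes off a finite set is constant. -/
theorem eq_of_hasDerivAt_zero_off_finset {S : Finset ℝ} {f : ℝ → ℂ} (hf : Continuous f)
    (hd : ∀ s ∉ S, HasDerivAt f 0 s) (a b : ℝ) : f a = f b := by
  have := integral_eq_of_hasDerivAt_off_countable (a := b) (b := a) f (fun _ => 0)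
    S.countable_toSet hf.continuousOn (fun x hx => hd x (by simpa using hx.2)) (by simp)
  simpa [eq_comm, sub_eq_zero] using this

/-- A continuous function whose derivative off a finite set is integrable is bounded. -/
theorem exists_norm_le_of_hasDerivAt {S : Finset ℝ} {r : ℝ → ℂ} (hr : Integrable r)
    {y : ℝ → ℂ} (hy : Continuous y)
    (hd : ∀ s ∉ S, HasDerivAt y (r s) s) : ∃ C, ∀ s, ‖y s‖ ≤ C := by
  refine ⟨‖y 0‖ + ∫ t, ‖r t‖, fun s => ?_⟩
  have h1 := integral_eq_of_hasDerivAt_off_countable (a := 0) (b := s) y r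
    S.countable_toSet hy.continuousOn (fun x hx => hd x (by simpa using hx.2))
    hr.intervalIntegrable
  have h2 : y s = y 0 + ∫ t in (0 : ℝ)..s, r t := by rw [h1]; ring
  rw [h2]
  refine (norm_add_le _ _).trans (add_le_add le_rfl ?_)
  refine (intervalIntegral.norm_integral_le_integral_norm_uIoc).trans ?_
  exact setIntegral_le_integral hr.norm (.of_forall fun _ => norm_nonneg _)

/-- A primitive on the left half lines of a function continuous off a finite set. -/
theorem hasDerivAt_integral_Iic {h : ℝ → ℂ} (hh : AEStronglyMeasurable h)
    (hi : ∀ b, IntegrableOn h (Iic b)) {s : ℝ} (hs : ContinuousAt h s) :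
    HasDerivAt (fun s => ∫ t in Iic s, h t) (h s) s := by
  have e : (fun s => ∫ t in Iic s, h t) = fun s => (∫ t in Iic 0, h t) + ∫ t in (0 : ℝ)..s, h t := by
    ext s
    rw [← intervalIntegral.integral_Iic_sub_Iic (hi 0) (hi s)]; ring
  rw [e]
  refine (intervalIntegral.integral_hasDerivAt_right ?_ hh.stronglyMeasurableAtFilter hs).const_add _
  exact ⟨(hi s).mono_set Ioc_subset_Iic_self, (hi 0).mono_set Ioc_subset_Iic_self⟩

theorem continuous_integral_Iic {h : ℝ → ℂ} (hi : ∀ b, IntegrableOn h (Iic b)) :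
    Continuous fun s => ∫ t in Iic s, h t := by
  have e : (fun s => ∫ t in Iic s, h t) = fun s => (∫ t in Iic 0, h t) + ∫ t in (0 : ℝ)..s, h t := by
    ext s
    rw [← intervalIntegral.integral_Iic_sub_Iic (hi 0) (hi s)]; ring
  rw [e]
  refine continuous_const.add (intervalIntegral.continuous_primitive (fun a b => ?_) 0)
  exact ⟨(hi b).mono_set Ioc_subset_Iic_self, (hi a).mono_set Ioc_subset_Iic_self⟩

theorem hasDerivAt_integral_Ioi {h : ℝ → ℂ} (hh : AEStronglyMeasurable h)
    (hi : ∀ b, IntegrableOn h (Ioi b)) {s : ℝ} (hs : ContinuousAt h s) :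
    HasDerivAt (fun s => ∫ t in Ioi s, h t) (-h s) s := by
  have e : (fun s => ∫ t in Ioi s, h t) = fun s => (∫ t in Ioi 0, h t) - ∫ t in (0 : ℝ)..s, h t := by
    ext s
    rw [← intervalIntegral.integral_Ioi_sub_Ioi' (hi 0) (hi s)]; ring
  rw [e]
  refine (intervalIntegral.integral_hasDerivAt_right ?_ hh.stronglyMeasurableAtFilter hs).const_sub _
  exact ⟨(hi 0).mono_set Ioc_subset_Ioi_self, (hi s).mono_set Ioc_subset_Ioi_self⟩

theorem continuous_integral_Ioi {h : ℝ → ℂ} (hi : ∀ b, IntegrableOn h (Ioi b)) :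
    Continuous fun s => ∫ t in Ioi s, h t := by
  have e : (fun s => ∫ t in Ioi s, h t) = fun s => (∫ t in Ioi 0, h t) - ∫ t in (0 : ℝ)..s, h t := by
    ext s
    rw [← intervalIntegral.integral_Ioi_sub_Ioi' (hi 0) (hi s)]; ring
  rw [e]
  refine continuous_const.sub (intervalIntegral.continuous_primitive (fun a b => ?_) 0)
  exact ⟨(hi a).mono_set Ioc_subset_Ioi_self, (hi b).mono_set Ioc_subset_Ioi_self⟩

/-! ### Progressive paths and their exponential integrals -/

/-- The properties of a progressive path used for the analysis in the path parameter: the path is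
continuous, continuously differentiable with nonvanishing derivative off the finite set `S`, and `Re(u γ)` increases from `-∞`
to `+∞`. -/
structure IsMonotonePath (u : ℂ) (γ : ℝ → ℂ) (S : Finset ℝ) : Prop where
  continuous : Continuous γ
  hasDerivAt : ∀ s ∉ S, HasDerivAt γ (deriv γ s) s
  continuousAt_deriv : ∀ s ∉ S, ContinuousAt (deriv γ) s
  deriv_ne_zero : ∀ s ∉ S, deriv γ s ≠ 0
  monotone : Monotone fun s => (u * γ s).re
  tendsto_atBot : Tendsto (fun s => (u * γ s).re) atBot atBot
  tendsto_atTop : Tendsto (fun s => (u * γ s).re) atTop atTop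

/-- A parameter outside the finite junction set is interior to a compact interval free of junctions,
so the regularity within that interval is regularity in the ordinary sense. -/
theorem IsProgressivePath.exists_isMonotonePath {u : ℂ} {Ξ : Set ℂ} {γ : ℝ → ℂ}
    (h : IsProgressivePath u Ξ γ) : ∃ S, IsMonotonePath u γ S := by
  obtain ⟨hc, S, hS⟩ := h.isR2Path
  have key : ∀ s ∉ S, ContDiffAt ℝ 2 γ s ∧ deriv γ s ≠ 0 := by
    intro s hs
    have : ((S : Set ℝ)ᶜ) ∈ 𝓝 s := S.finite_toSet.isClosed.isOpen_compl.mem_nhds (by simpa using hs)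
    obtain ⟨ε, hε, hεS⟩ := Metric.mem_nhds_iff.1 this
    rw [Real.ball_eq_Ioo] at hεS
    obtain ⟨h1, h2⟩ := hS (s - ε) (s + ε) (by linarith)
      (disjoint_left.2 fun x hx hx' => hεS hx hx')
    have hn : Icc (s - ε) (s + ε) ∈ 𝓝 s := Icc_mem_nhds (by linarith) (by linarith)
    exact ⟨h1.contDiffAt hn, by
      rw [← derivWithin_of_mem_nhds hn]; exact h2 s (mem_of_mem_nhds hn)⟩
  exact ⟨S, hc, fun s hs => ((key s hs).1.differentiableAt (by norm_num)).hasDerivAt,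
    fun s hs => ((key s hs).1.derivWithin (m := 1) (by norm_num)).continuousAt,
    fun s hs => (key s hs).2, h.monotone, h.tendsto_atBot, h.tendsto_atTop⟩

/-- The solution `e^{-uγ(s)} ∫_{-∞}^s e^{uγ} r` of `y' = -uγ' y + r`. -/
def bwdIntegral (u : ℂ) (γ r : ℝ → ℂ) (s : ℝ) : ℂ :=
  Complex.exp (-(u * γ s)) * ∫ t in Iic s, Complex.exp (u * γ t) * r t

/-- The solution `e^{uγ(s)} ∫_s^∞ e^{-uγ} r` of `y' = uγ' y - r`. -/
def fwdIntegral (u : ℂ) (γ r : ℝ → ℂ) (s : ℝ) : ℂ :=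
  Complex.exp (u * γ s) * ∫ t in Ioi s, Complex.exp (-(u * γ t)) * r t

namespace IsMonotonePath

variable {u : ℂ} {γ : ℝ → ℂ} {S : Finset ℝ} (hγ : IsMonotonePath u γ S) {r : ℝ → ℂ}
  (hr : Integrable r)
include hγ

theorem continuous_exp : Continuous fun s => Complex.exp (u * γ s) :=
  Complex.continuous_exp.comp (continuous_const.mul hγ.continuous)

theorem continuous_exp_neg : Continuous fun s => Complex.exp (-(u * γ s)) :=
  Complex.continuous_exp.comp (continuous_const.mul hγ.continuous).neg

theorem hasDerivAt_exp {s : ℝ} (hs : s ∉ S) :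
    HasDerivAt (fun s => Complex.exp (u * γ s)) (Complex.exp (u * γ s) * (u * deriv γ s)) s :=
  ((hγ.hasDerivAt s hs).const_mul u).cexp

theorem hasDerivAt_exp_neg {s : ℝ} (hs : s ∉ S) :
    HasDerivAt (fun s => Complex.exp (-(u * γ s)))
      (Complex.exp (-(u * γ s)) * (-(u * deriv γ s))) s :=
  ((hγ.hasDerivAt s hs).const_mul u).neg.cexp

include hr

theorem integrableOn_Iic (b : ℝ) :
    IntegrableOn (fun t => Complex.exp (u * γ t) * r t) (Iic b) := by
  refine Integrable.bdd_mul (c := Real.exp (u * γ b).re) hr.integrableOn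
    hγ.continuous_exp.aestronglyMeasurable ?_
  refine (ae_restrict_iff' measurableSet_Iic).2 (.of_forall fun t ht => ?_)
  rw [Complex.norm_exp]
  exact Real.exp_le_exp.2 (hγ.monotone ht)

theorem integrableOn_Ioi (b : ℝ) :
    IntegrableOn (fun t => Complex.exp (-(u * γ t)) * r t) (Ioi b) := by
  refine Integrable.bdd_mul (c := Real.exp (-(u * γ b).re)) hr.integrableOn
    hγ.continuous_exp_neg.aestronglyMeasurable ?_
  refine (ae_restrict_iff' measurableSet_Ioi).2 (.of_forall fun t ht => ?_)
  rw [Complex.norm_exp, Complex.neg_re]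
  exact Real.exp_le_exp.2 (neg_le_neg (hγ.monotone (le_of_lt ht)))

theorem norm_bwdIntegral_le (s : ℝ) : ‖bwdIntegral u γ r s‖ ≤ ∫ t in Iic s, ‖r t‖ := by
  rw [bwdIntegral, ← integral_const_mul]
  refine norm_integral_le_of_norm_le hr.norm.integrableOn ?_
  refine (ae_restrict_iff' measurableSet_Iic).2 (.of_forall fun t ht => ?_)
  rw [← mul_assoc, ← Complex.exp_add, norm_mul, Complex.norm_exp]
  refine mul_le_of_le_one_left (norm_nonneg _) (Real.exp_le_one_iff.2 ?_)
  have : (u * γ t).re ≤ (u * γ s).re := hγ.monotone ht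
  simp only [Complex.add_re, Complex.neg_re]
  linarith

theorem norm_fwdIntegral_le (s : ℝ) : ‖fwdIntegral u γ r s‖ ≤ ∫ t in Ioi s, ‖r t‖ := by
  rw [fwdIntegral, ← integral_const_mul]
  refine norm_integral_le_of_norm_le hr.norm.integrableOn ?_
  refine (ae_restrict_iff' measurableSet_Ioi).2 (.of_forall fun t ht => ?_)
  rw [← mul_assoc, ← Complex.exp_add, norm_mul, Complex.norm_exp]
  refine mul_le_of_le_one_left (norm_nonneg _) (Real.exp_le_one_iff.2 ?_)
  have : (u * γ s).re ≤ (u * γ t).re := hγ.monotone (le_of_lt ht)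
  simp only [Complex.add_re, Complex.neg_re]
  linarith

/-- The two integrals run over complementary half lines, so together they cost one total integral
instead of two. This produces the factors ½ in the final bounds. -/
theorem norm_bwdIntegral_add_norm_fwdIntegral_le (s : ℝ) :
    ‖bwdIntegral u γ r s‖ + ‖fwdIntegral u γ r s‖ ≤ ∫ t, ‖r t‖ := by
  rw [← intervalIntegral.integral_Iic_add_Ioi (b := s) hr.norm.integrableOn hr.norm.integrableOn]
  exact add_le_add (hγ.norm_bwdIntegral_le hr s) (hγ.norm_fwdIntegral_le hr s)

theorem norm_bwdIntegral_le_integral (s : ℝ) : ‖bwdIntegral u γ r s‖ ≤ ∫ t, ‖r t‖ :=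
  (le_add_of_nonneg_right (norm_nonneg _)).trans (hγ.norm_bwdIntegral_add_norm_fwdIntegral_le hr s)

theorem norm_fwdIntegral_le_integral (s : ℝ) : ‖fwdIntegral u γ r s‖ ≤ ∫ t, ‖r t‖ :=
  (le_add_of_nonneg_left (norm_nonneg _)).trans (hγ.norm_bwdIntegral_add_norm_fwdIntegral_le hr s)

theorem continuous_bwdIntegral : Continuous (bwdIntegral u γ r) :=
  hγ.continuous_exp_neg.mul (continuous_integral_Iic (hγ.integrableOn_Iic hr))

theorem continuous_fwdIntegral : Continuous (fwdIntegral u γ r) :=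
  hγ.continuous_exp.mul (continuous_integral_Ioi (hγ.integrableOn_Ioi hr))

theorem hasDerivAt_bwdIntegral {s : ℝ} (hs : s ∉ S) (hrs : ContinuousAt r s) :
    HasDerivAt (bwdIntegral u γ r) (-(u * deriv γ s) * bwdIntegral u γ r s + r s) s := by
  have h1 := hasDerivAt_integral_Iic
    (hγ.continuous_exp.aestronglyMeasurable.mul hr.aestronglyMeasurable) (hγ.integrableOn_Iic hr)
    (hγ.continuous_exp.continuousAt.mul hrs)
  refine ((hγ.hasDerivAt_exp_neg hs).mul h1).congr_deriv ?_
  have h2 : Complex.exp (-(u * γ s)) * Complex.exp (u * γ s) = 1 := by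
    rw [← Complex.exp_add]; simp
  simp only [bwdIntegral, Pi.mul_apply]
  linear_combination (r s) * h2

theorem hasDerivAt_fwdIntegral {s : ℝ} (hs : s ∉ S) (hrs : ContinuousAt r s) :
    HasDerivAt (fwdIntegral u γ r) (u * deriv γ s * fwdIntegral u γ r s - r s) s := by
  have h1 := hasDerivAt_integral_Ioi
    (hγ.continuous_exp_neg.aestronglyMeasurable.mul hr.aestronglyMeasurable)
    (hγ.integrableOn_Ioi hr) (hγ.continuous_exp_neg.continuousAt.mul hrs)
  refine ((hγ.hasDerivAt_exp hs).mul h1).congr_deriv ?_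
  have h2 : Complex.exp (u * γ s) * Complex.exp (-(u * γ s)) = 1 := by
    rw [← Complex.exp_add]; simp
  simp only [fwdIntegral, Pi.mul_apply]
  linear_combination -(r s) * h2

/-- Every solution of `y' = -uγ' y + r` is `bwdIntegral` plus a multiple of `e^{-uγ}`. -/
theorem exists_eq_bwdIntegral_add (hrc : ∀ s ∉ S, ContinuousAt r s) {y : ℝ → ℂ}
    (hy : Continuous y) (hd : ∀ s ∉ S, HasDerivAt y (-(u * deriv γ s) * y s + r s) s) :
    ∃ c : ℂ, ∀ s, y s = bwdIntegral u γ r s + c * Complex.exp (-(u * γ s)) := by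
  -- The difference of two solutions times the integrating factor `e^{uγ}` is constant along the
  -- path; its value at `0` is the constant sought.
  refine ⟨(y 0 - bwdIntegral u γ r 0) * Complex.exp (u * γ 0), fun s => ?_⟩
  have := eq_of_hasDerivAt_zero_off_finset (S := S)
    (f := fun s => (y s - bwdIntegral u γ r s) * Complex.exp (u * γ s))
    ((hy.sub (hγ.continuous_bwdIntegral hr)).mul hγ.continuous_exp) (fun s hs => by
      refine (((hd s hs).sub (hγ.hasDerivAt_bwdIntegral hr hs (hrc s hs))).mul
        (hγ.hasDerivAt_exp hs)).congr_deriv ?_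
      simp only [Pi.sub_apply]
      ring) 0 s
  have h2 : Complex.exp (u * γ s) * Complex.exp (-(u * γ s)) = 1 := by
    rw [← Complex.exp_add]; simp
  rw [this]
  linear_combination -(y s - bwdIntegral u γ r s) * h2

/-- Every solution of `y' = uγ' y - r` is `fwdIntegral` plus a multiple of `e^{uγ}`. -/
theorem exists_eq_fwdIntegral_add (hrc : ∀ s ∉ S, ContinuousAt r s) {y : ℝ → ℂ}
    (hy : Continuous y) (hd : ∀ s ∉ S, HasDerivAt y (u * deriv γ s * y s - r s) s) :
    ∃ c : ℂ, ∀ s, y s = fwdIntegral u γ r s + c * Complex.exp (u * γ s) := by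
  refine ⟨(y 0 - fwdIntegral u γ r 0) * Complex.exp (-(u * γ 0)), fun s => ?_⟩
  have := eq_of_hasDerivAt_zero_off_finset (S := S)
    (f := fun s => (y s - fwdIntegral u γ r s) * Complex.exp (-(u * γ s)))
    ((hy.sub (hγ.continuous_fwdIntegral hr)).mul hγ.continuous_exp_neg) (fun s hs => by
      refine (((hd s hs).sub (hγ.hasDerivAt_fwdIntegral hr hs (hrc s hs))).mul
        (hγ.hasDerivAt_exp_neg hs)).congr_deriv ?_
      simp only [Pi.sub_apply]
      ring) 0 s
  have h2 : Complex.exp (u * γ s) * Complex.exp (-(u * γ s)) = 1 := by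
    rw [← Complex.exp_add]; simp
  rw [this]
  linear_combination -(y s - fwdIntegral u γ r s) * h2

omit hr in
-- A bound near the end `+∞` suffices, because |e^{uγ}| = e^{Re(uγ)} tends to infinity there. The
-- weak form matters when only a half line is under control.
theorem eq_zero_of_bounded_exp {c : ℂ} {C : ℝ}
    (h : ∀ᶠ s in atTop, ‖c * Complex.exp (u * γ s)‖ ≤ C) : c = 0 := by
  by_contra hc
  have h1 : Tendsto (fun s => ‖c * Complex.exp (u * γ s)‖) atTop atTop := by
    simp only [norm_mul, Complex.norm_exp]
    exact (Real.tendsto_exp_atTop.comp hγ.tendsto_atTop).const_mul_atTop (norm_pos_iff.2 hc)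
  obtain ⟨s, hs, hs'⟩ := (h.and (h1.eventually_gt_atTop C)).exists
  linarith

omit hr in
theorem eq_zero_of_bounded_exp_neg {c : ℂ} {C : ℝ}
    (h : ∀ᶠ s in atBot, ‖c * Complex.exp (-(u * γ s))‖ ≤ C) : c = 0 := by
  by_contra hc
  have h1 : Tendsto (fun s => ‖c * Complex.exp (-(u * γ s))‖) atBot atTop := by
    simp only [norm_mul, Complex.norm_exp, Complex.neg_re]
    exact (Real.tendsto_exp_atTop.comp (tendsto_neg_atBot_atTop.comp
      hγ.tendsto_atBot)).const_mul_atTop (norm_pos_iff.2 hc)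
  obtain ⟨s, hs, hs'⟩ := (h.and (h1.eventually_gt_atTop C)).exists
  linarith

/-- A bounded solution of `y' = -uγ' y + r` is `bwdIntegral`. -/
theorem eq_bwdIntegral_of_bounded (hrc : ∀ s ∉ S, ContinuousAt r s) {y : ℝ → ℂ}
    (hy : Continuous y) (hd : ∀ s ∉ S, HasDerivAt y (-(u * deriv γ s) * y s + r s) s) {C : ℝ}
    (hC : ∀ s, ‖y s‖ ≤ C) (s : ℝ) : y s = bwdIntegral u γ r s := by
  obtain ⟨c, hc⟩ := hγ.exists_eq_bwdIntegral_add hr hrc hy hd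
  have : c = 0 := by
    refine hγ.eq_zero_of_bounded_exp_neg (C := C + ∫ t, ‖r t‖) (.of_forall fun s => ?_)
    have e : c * Complex.exp (-(u * γ s)) = y s - bwdIntegral u γ r s := by rw [hc]; ring
    rw [e]
    exact (norm_sub_le _ _).trans (add_le_add (hC s) (hγ.norm_bwdIntegral_le_integral hr s))
  simpa [this] using hc s

/-- A bounded solution of `y' = uγ' y - r` is `fwdIntegral`. -/
theorem eq_fwdIntegral_of_bounded (hrc : ∀ s ∉ S, ContinuousAt r s) {y : ℝ → ℂ}
    (hy : Continuous y) (hd : ∀ s ∉ S, HasDerivAt y (u * deriv γ s * y s - r s) s) {C : ℝ}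
    (hC : ∀ s, ‖y s‖ ≤ C) (s : ℝ) : y s = fwdIntegral u γ r s := by
  obtain ⟨c, hc⟩ := hγ.exists_eq_fwdIntegral_add hr hrc hy hd
  have : c = 0 := by
    refine hγ.eq_zero_of_bounded_exp (C := C + ∫ t, ‖r t‖) (.of_forall fun s => ?_)
    have e : c * Complex.exp (u * γ s) = y s - fwdIntegral u γ r s := by rw [hc]; ring
    rw [e]
    exact (norm_sub_le _ _).trans (add_le_add (hC s) (hγ.norm_fwdIntegral_le_integral hr s))
  simpa [this] using hc s

theorem bwdIntegral_sub {r' : ℝ → ℂ} (hr' : Integrable r') (s : ℝ) :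
    bwdIntegral u γ (fun t => r t - r' t) s = bwdIntegral u γ r s - bwdIntegral u γ r' s := by
  simp only [bwdIntegral, mul_sub]
  rw [integral_sub (hγ.integrableOn_Iic hr s) (hγ.integrableOn_Iic hr' s), mul_sub]

theorem fwdIntegral_sub {r' : ℝ → ℂ} (hr' : Integrable r') (s : ℝ) :
    fwdIntegral u γ (fun t => r t - r' t) s = fwdIntegral u γ r s - fwdIntegral u γ r' s := by
  simp only [fwdIntegral, mul_sub]
  rw [integral_sub (hγ.integrableOn_Ioi hr s) (hγ.integrableOn_Ioi hr' s), mul_sub]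

end IsMonotonePath

/-! ### The integral equation along the path and its error bounds -/

namespace IsMonotonePath

theorem integrable_mul_deriv {γ k : ℝ → ℂ} (hk : Continuous k)
    (hkI : Integrable fun s => ‖k s‖ * ‖deriv γ s‖) : Integrable fun s => k s * deriv γ s := by
  refine hkI.mono (hk.aestronglyMeasurable.mul (stronglyMeasurable_deriv γ).aestronglyMeasurable)
    (.of_forall fun s => ?_)
  simp

theorem integrable_mul_deriv_mul {γ k e : ℝ → ℂ} (hk : Continuous k)
    (hkI : Integrable fun s => ‖k s‖ * ‖deriv γ s‖) (he : Continuous e) {B : ℝ}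
    (hB : ∀ s, ‖e s‖ ≤ B) : Integrable fun s => k s * deriv γ s * e s :=
  (integrable_mul_deriv hk hkI).mul_bdd (c := B) he.aestronglyMeasurable (.of_forall hB)

theorem integral_norm_mul_deriv_mul_le {γ k e : ℝ → ℂ} (hk : Continuous k)
    (hkI : Integrable fun s => ‖k s‖ * ‖deriv γ s‖) (he : Continuous e) {B : ℝ}
    (hB : ∀ s, ‖e s‖ ≤ B) :
    ∫ s, ‖k s * deriv γ s * e s‖ ≤ (∫ s, ‖k s‖ * ‖deriv γ s‖) * B := by
  rw [← integral_mul_const]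
  refine integral_mono (integrable_mul_deriv_mul hk hkI he hB).norm (hkI.mul_const B) fun s => ?_
  simp only [norm_mul]
  exact mul_le_mul_of_nonneg_left (hB s) (by positivity)

variable {u : ℂ} {γ : ℝ → ℂ} {S : Finset ℝ} (hγ : IsMonotonePath u γ S)
include hγ

theorem norm_fwd_add_bwd_mul_le {k e : ℝ → ℂ} (hk : Continuous k)
    (hkI : Integrable fun s => ‖k s‖ * ‖deriv γ s‖) (he : Continuous e) {B : ℝ}
    (hB : ∀ s, ‖e s‖ ≤ B) (s : ℝ) :
    ‖bwdIntegral u γ (fun t => k t * deriv γ t * e t) s‖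
      + ‖fwdIntegral u γ (fun t => k t * deriv γ t * e t) s‖
      ≤ (∫ s, ‖k s‖ * ‖deriv γ s‖) * B :=
  (hγ.norm_bwdIntegral_add_norm_fwdIntegral_le (integrable_mul_deriv_mul hk hkI he hB) s).trans
    (integral_norm_mul_deriv_mul_le hk hkI he hB)

/-- The Volterra-Fredholm equation on the path has a bounded solution when the kernel is small. -/
theorem exists_bounded_fixedPoint {k e₀ : ℝ → ℂ} (hk : Continuous k)
    (hkI : Integrable fun s => ‖k s‖ * ‖deriv γ s‖)
    (hu : 1 / 2 * (∫ s, ‖k s‖ * ‖deriv γ s‖) < ‖u‖) (he₀ : Continuous e₀) {B : ℝ}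
    (hB : ∀ s, ‖e₀ s‖ ≤ B) :
    ∃ e : ℝ → ℂ, Continuous e ∧
      (∀ s, ‖e s‖ ≤ (1 - 1 / (2 * ‖u‖) * ∫ s, ‖k s‖ * ‖deriv γ s‖)⁻¹ * B) ∧
      ∀ s, e s = e₀ s - (fwdIntegral u γ (fun t => k t * deriv γ t * e t) s
        + bwdIntegral u γ (fun t => k t * deriv γ t * e t) s) / (2 * u) := by
  set I := ∫ s, ‖k s‖ * ‖deriv γ s‖ with hI
  have hI0 : 0 ≤ I := integral_nonneg fun s => by positivity
  have hu0 : 0 < ‖u‖ := lt_of_le_of_lt (by positivity) hu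
  set κ := 1 / (2 * ‖u‖) * I with hκ
  have hκ0 : 0 ≤ κ := by positivity
  have hκ1 : κ < 1 := by
    rw [hκ, one_div, inv_mul_lt_iff₀ (by positivity)]; linarith
  have hint : ∀ e : BoundedContinuousFunction ℝ ℂ,
      Integrable fun t => k t * deriv γ t * e t := fun e =>
    integrable_mul_deriv_mul hk hkI e.continuous e.norm_coe_le_norm
  have hest : ∀ (e : ℝ → ℂ) (b : ℝ), Continuous e → (∀ s, ‖e s‖ ≤ b) → ∀ s,
      ‖(fwdIntegral u γ (fun t => k t * deriv γ t * e t) s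
        + bwdIntegral u γ (fun t => k t * deriv γ t * e t) s) / (2 * u)‖ ≤ κ * b := by
    intro e b he hb s
    have h1 := hγ.norm_fwd_add_bwd_mul_le hk hkI he hb s
    have h2 := norm_add_le (fwdIntegral u γ (fun t => k t * deriv γ t * e t) s)
      (bwdIntegral u γ (fun t => k t * deriv γ t * e t) s)
    rw [norm_div, norm_mul, Complex.norm_ofNat, div_le_iff₀ (by positivity), hκ]
    have : 1 / (2 * ‖u‖) * I * b * (2 * ‖u‖) = I * b := by field_simp
    rw [this]
    linarith
  -- Affine map of the bounded continuous functions into themselves; its linear part has norm at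
  -- most `κ < 1`, so Banach's theorem applies.
  let T : BoundedContinuousFunction ℝ ℂ → BoundedContinuousFunction ℝ ℂ := fun e =>
    BoundedContinuousFunction.ofNormedAddCommGroup
      (fun s => e₀ s - (fwdIntegral u γ (fun t => k t * deriv γ t * e t) s
        + bwdIntegral u γ (fun t => k t * deriv γ t * e t) s) / (2 * u))
      (he₀.sub (((hγ.continuous_fwdIntegral (hint e)).add
        (hγ.continuous_bwdIntegral (hint e))).div_const _))
      (B + κ * ‖e‖)
      (fun s => (norm_sub_le _ _).trans
        (add_le_add (hB s) (hest e _ e.continuous e.norm_coe_le_norm s)))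
  have hT : ContractingWith ⟨κ, hκ0⟩ T := by
    refine ⟨by exact_mod_cast hκ1, LipschitzWith.of_dist_le_mul fun e e' => ?_⟩
    rw [dist_eq_norm, dist_eq_norm]
    refine (BoundedContinuousFunction.norm_le (by positivity)).2 fun s => ?_
    have h3 := hest (fun t => e t - e' t) ‖e - e'‖ (e.continuous.sub e'.continuous)
      (fun s => (e - e').norm_coe_le_norm s) s
    have h4 : (fun t => k t * deriv γ t * (e t - e' t))
        = fun t => k t * deriv γ t * e t - k t * deriv γ t * e' t := by
      ext t; ring
    rw [h4, hγ.fwdIntegral_sub (hint e) (hint e'), hγ.bwdIntegral_sub (hint e) (hint e')] at h3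
    refine (le_of_eq ?_).trans h3
    rw [← norm_neg]
    congr 1
    rw [BoundedContinuousFunction.sub_apply]
    simp only [T, BoundedContinuousFunction.coe_ofNormedAddCommGroup]
    ring
  have hfix : ∀ s, ContractingWith.fixedPoint T hT s = e₀ s - (fwdIntegral u γ
      (fun t => k t * deriv γ t * ContractingWith.fixedPoint T hT t) s
      + bwdIntegral u γ (fun t => k t * deriv γ t * ContractingWith.fixedPoint T hT t) s)
        / (2 * u) := fun s =>
    (congrArg (fun e : BoundedContinuousFunction ℝ ℂ => e s) hT.fixedPoint_isFixedPt).symm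
  set e := ContractingWith.fixedPoint T hT
  refine ⟨e, e.continuous, fun s => (e.norm_coe_le_norm s).trans ?_, hfix⟩
  have hB0 : 0 ≤ B := (norm_nonneg _).trans (hB 0)
  have h5 : ‖e‖ ≤ B + κ * ‖e‖ := by
    refine (BoundedContinuousFunction.norm_le (by positivity)).2 fun s => ?_
    rw [hfix s]
    exact (norm_sub_le _ _).trans
      (add_le_add (hB s) (hest e _ e.continuous e.norm_coe_le_norm s))
  rw [le_inv_mul_iff₀ (by linarith)]
  linarith

/-- A bounded solution along the path of the homogeneous equation vanishes. -/
theorem eq_zero_of_bounded {k v v₁ : ℝ → ℂ} (hk : Continuous k)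
    (hkI : Integrable fun s => ‖k s‖ * ‖deriv γ s‖)
    (hu : 1 / 2 * (∫ s, ‖k s‖ * ‖deriv γ s‖) < ‖u‖) (hv : Continuous v) (hv₁ : Continuous v₁)
    (hd : ∀ s ∉ S, HasDerivAt v (v₁ s * deriv γ s) s)
    (hd₁ : ∀ s ∉ S, HasDerivAt v₁ ((u ^ 2 + k s) * v s * deriv γ s) s)
    (hb : BddAbove (range fun s => ‖v s‖)) (s : ℝ) : v s = 0 := by
  set I := ∫ s, ‖k s‖ * ‖deriv γ s‖ with hI
  have hI0 : 0 ≤ I := integral_nonneg fun s => by positivity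
  have hu0 : 0 < ‖u‖ := lt_of_le_of_lt (by positivity) hu
  set C := ⨆ s, ‖v s‖ with hC
  have hvC : ∀ s, ‖v s‖ ≤ C := fun s => le_ciSup hb s
  set ρ : ℝ → ℂ := fun t => k t * deriv γ t * v t with hρ
  have hρI : Integrable ρ := integrable_mul_deriv_mul hk hkI hv hvC
  have hρc : ∀ s ∉ S, ContinuousAt ρ s := fun s hs =>
    (hk.continuousAt.mul (hγ.continuousAt_deriv s hs)).mul hv.continuousAt
  -- The combinations `v₁ ± u * v` diagonalise the constant-coefficient part, splitting the equation
  -- into two first-order equations with source `ρ`.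
  obtain ⟨c, hc⟩ := hγ.exists_eq_fwdIntegral_add hρI hρc (y := fun s => -(v₁ s + u * v s))
    (hv₁.add (continuous_const.mul hv)).neg (fun s hs => by
      refine ((hd₁ s hs).add ((hd s hs).const_mul u)).neg.congr_deriv ?_
      simp only [hρ]; ring)
  obtain ⟨c', hc'⟩ := hγ.exists_eq_bwdIntegral_add hρI hρc (y := fun s => v₁ s - u * v s)
    (hv₁.sub (continuous_const.mul hv)) (fun s hs => by
      refine ((hd₁ s hs).sub ((hd s hs).const_mul u)).congr_deriv ?_
      simp only [hρ]; ring)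
  have hsum : ∀ s, -(2 * u * v s) = fwdIntegral u γ ρ s + bwdIntegral u γ ρ s
      + c * Complex.exp (u * γ s) + c' * Complex.exp (-(u * γ s)) := fun s => by
    linear_combination hc s + hc' s
  have hbound : ∀ s, ‖-(2 * u * v s) - fwdIntegral u γ ρ s - bwdIntegral u γ ρ s‖
      ≤ 2 * ‖u‖ * C + ∫ t, ‖ρ t‖ := by
    intro s
    have h1 := norm_sub_le (-(2 * u * v s) - fwdIntegral u γ ρ s) (bwdIntegral u γ ρ s)
    have h2 := norm_sub_le (-(2 * u * v s)) (fwdIntegral u γ ρ s)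
    have h3 := hγ.norm_bwdIntegral_add_norm_fwdIntegral_le hρI s
    have h4 : ‖-(2 * u * v s)‖ ≤ 2 * ‖u‖ * C := by
      rw [norm_neg, norm_mul, norm_mul, Complex.norm_ofNat]
      exact mul_le_mul_of_nonneg_left (hvC s) (by positivity)
    linarith
  -- Since `v₁` is not known to be bounded, only the sum `hsum` can be used. For `s ≥ 0` the
  -- exponential with `c'` stays bounded, which isolates `c`; with `c` gone, the other end isolates
  -- `c'`.
  have hc0 : c = 0 := by
    refine hγ.eq_zero_of_bounded_exp
      (C := 2 * ‖u‖ * C + (∫ t, ‖ρ t‖) + ‖c'‖ * Real.exp (-(u * γ 0).re)) ?_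
    filter_upwards [eventually_ge_atTop 0] with s hs
    have e : c * Complex.exp (u * γ s) = (-(2 * u * v s) - fwdIntegral u γ ρ s
        - bwdIntegral u γ ρ s) - c' * Complex.exp (-(u * γ s)) := by rw [hsum]; ring
    rw [e]
    refine (norm_sub_le _ _).trans (add_le_add (hbound s) ?_)
    rw [norm_mul, Complex.norm_exp, Complex.neg_re]
    exact mul_le_mul_of_nonneg_left (Real.exp_le_exp.2 (neg_le_neg (hγ.monotone hs)))
      (norm_nonneg _)
  have hc0' : c' = 0 := by
    refine hγ.eq_zero_of_bounded_exp_neg (C := 2 * ‖u‖ * C + ∫ t, ‖ρ t‖) (.of_forall fun s => ?_)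
    have e : c' * Complex.exp (-(u * γ s)) = -(2 * u * v s) - fwdIntegral u γ ρ s
        - bwdIntegral u γ ρ s := by rw [hsum, hc0]; ring
    rw [e]
    exact hbound s
  have hle : ∀ s, 2 * ‖u‖ * ‖v s‖ ≤ I * C := by
    intro s
    have h1 := hsum s
    simp only [hc0, hc0', zero_mul, add_zero] at h1
    have h2 := hγ.norm_fwd_add_bwd_mul_le hk hkI hv hvC s
    have h3 := norm_add_le (fwdIntegral u γ ρ s) (bwdIntegral u γ ρ s)
    rw [← h1, norm_neg, norm_mul, norm_mul, Complex.norm_ofNat] at h3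
    linarith
  have hC0 : 0 ≤ C := (norm_nonneg _).trans (hvC 0)
  have hCle : C ≤ I * C / (2 * ‖u‖) := ciSup_le fun s => by
    rw [le_div_iff₀ (by positivity)]
    linarith [hle s]
  rw [le_div_iff₀ (by positivity)] at hCle
  have : C ≤ 0 := by nlinarith
  exact norm_le_zero_iff.1 ((hvC s).trans this)

/-- The inhomogeneous equation `e'' = (u² + k) e - g` along the path has a solution that satisfies
the error bounds. -/
theorem exists_solution_with_bounds {k g g₁ g₂ : ℝ → ℂ} (hk : Continuous k)
    (hkI : Integrable fun s => ‖k s‖ * ‖deriv γ s‖)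
    (hu : 1 / 2 * (∫ s, ‖k s‖ * ‖deriv γ s‖) < ‖u‖)
    (hg : Continuous g) (hg₁ : Continuous g₁) (hg₂ : Continuous g₂)
    (hgd : ∀ s ∉ S, HasDerivAt g (g₁ s * deriv γ s) s)
    (hgd₁ : ∀ s ∉ S, HasDerivAt g₁ (g₂ s * deriv γ s) s)
    (hgb : BddAbove (range fun s => ‖g s‖))
    (hg₁I : Integrable fun s => ‖g₁ s‖ * ‖deriv γ s‖)
    (hg₂I : Integrable fun s => ‖g₂ s‖ * ‖deriv γ s‖) :
    ∃ e e₁ : ℝ → ℂ, Continuous e ∧ Continuous e₁ ∧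
      (∀ s ∉ S, HasDerivAt e (e₁ s * deriv γ s) s) ∧
      (∀ s ∉ S, HasDerivAt e₁ (((u ^ 2 + k s) * e s - g s) * deriv γ s) s) ∧
      (∀ s, ‖e s‖ ≤ 1 / ‖u‖ ^ 2 * (‖g s‖ + 1 / 2 * ∫ s, ‖g₁ s‖ * ‖deriv γ s‖)
        + ((⨆ s, ‖g s‖) + 1 / 2 * ∫ s, ‖g₁ s‖ * ‖deriv γ s‖) / (2 * ‖u‖ ^ 3)
          * (1 - 1 / (2 * ‖u‖) * ∫ s, ‖k s‖ * ‖deriv γ s‖)⁻¹ * ∫ s, ‖k s‖ * ‖deriv γ s‖) ∧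
      (∀ s, ‖e₁ s‖ ≤ 1 / ‖u‖ ^ 2 * (‖g₁ s‖ + 1 / 2 * (∫ s, ‖g₂ s‖ * ‖deriv γ s‖)
        + 1 / 2 * ((⨆ s, ‖g s‖) + 1 / 2 * ∫ s, ‖g₁ s‖ * ‖deriv γ s‖)
          * (1 - 1 / (2 * ‖u‖) * ∫ s, ‖k s‖ * ‖deriv γ s‖)⁻¹ * ∫ s, ‖k s‖ * ‖deriv γ s‖)) := by
  set I := ∫ s, ‖k s‖ * ‖deriv γ s‖ with hI
  set I₁ := ∫ s, ‖g₁ s‖ * ‖deriv γ s‖ with hI₁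
  set I₂ := ∫ s, ‖g₂ s‖ * ‖deriv γ s‖ with hI₂
  set L := (⨆ s, ‖g s‖) + 1 / 2 * I₁ with hL
  have hI0 : 0 ≤ I := integral_nonneg fun s => by positivity
  have hu0 : 0 < ‖u‖ := lt_of_le_of_lt (by positivity) hu
  have hune : u ≠ 0 := norm_pos_iff.1 hu0
  set r : ℝ → ℂ := fun s => g₁ s * deriv γ s with hr
  set r₂ : ℝ → ℂ := fun s => g₂ s * deriv γ s with hr₂
  have hrI : Integrable r := integrable_mul_deriv hg₁ hg₁I
  have hr₂I : Integrable r₂ := integrable_mul_deriv hg₂ hg₂I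
  have hrc : ∀ s ∉ S, ContinuousAt r s := fun s hs =>
    hg₁.continuousAt.mul (hγ.continuousAt_deriv s hs)
  have hr₂c : ∀ s ∉ S, ContinuousAt r₂ s := fun s hs =>
    hg₂.continuousAt.mul (hγ.continuousAt_deriv s hs)
  have hrn : ∫ s, ‖r s‖ = I₁ := by simp [hr, hI₁]
  have hr₂n : ∫ s, ‖r₂ s‖ = I₂ := by simp [hr₂, hI₂]
  -- Solution of e₀'' = u² e₀ - g by variation of parameters, after one integration by parts in both
  -- integrals; `e₀₁` is its derivative in ξ.
  set e₀ : ℝ → ℂ := fun s => (g s - (bwdIntegral u γ r s - fwdIntegral u γ r s) / 2) / u ^ 2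
    with he₀
  set e₀₁ : ℝ → ℂ := fun s => (fwdIntegral u γ r s + bwdIntegral u γ r s) / (2 * u) with he₀₁
  have hbc := hγ.continuous_bwdIntegral hrI
  have hfc := hγ.continuous_fwdIntegral hrI
  have he₀c : Continuous e₀ := (hg.sub ((hbc.sub hfc).div_const _)).div_const _
  have he₀₁c : Continuous e₀₁ := (hfc.add hbc).div_const _
  have he₀n : ∀ s, ‖e₀ s‖ ≤ 1 / ‖u‖ ^ 2 * (‖g s‖ + 1 / 2 * I₁) := by
    intro s
    have h1 := hγ.norm_bwdIntegral_add_norm_fwdIntegral_le hrI s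
    have h2 := norm_sub_le (bwdIntegral u γ r s) (fwdIntegral u γ r s)
    have h3 := norm_sub_le (g s) ((bwdIntegral u γ r s - fwdIntegral u γ r s) / 2)
    rw [norm_div, Complex.norm_ofNat] at h3
    rw [he₀, norm_div, norm_pow, div_eq_inv_mul, one_div]
    refine mul_le_mul_of_nonneg_left ?_ (by positivity)
    linarith
  have he₀B : ∀ s, ‖e₀ s‖ ≤ 1 / ‖u‖ ^ 2 * L := fun s =>
    (he₀n s).trans (mul_le_mul_of_nonneg_left (by linarith [le_ciSup hgb s]) (by positivity))
  obtain ⟨e, hec, heB, hefix⟩ := hγ.exists_bounded_fixedPoint hk hkI hu he₀c he₀B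
  set B := (1 - 1 / (2 * ‖u‖) * I)⁻¹ * (1 / ‖u‖ ^ 2 * L) with hBdef
  set ρ : ℝ → ℂ := fun t => k t * deriv γ t * e t with hρ
  have hρI : Integrable ρ := integrable_mul_deriv_mul hk hkI hec heB
  have hρc : ∀ s ∉ S, ContinuousAt ρ s := fun s hs =>
    (hk.continuousAt.mul (hγ.continuousAt_deriv s hs)).mul hec.continuousAt
  have hρn := fun s => hγ.norm_fwd_add_bwd_mul_le hk hkI hec heB s
  have hbρ := hγ.continuous_bwdIntegral hρI
  have hfρ := hγ.continuous_fwdIntegral hρI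
  have hefun : e = fun s => e₀ s - (fwdIntegral u γ ρ s + bwdIntegral u γ ρ s) / (2 * u) :=
    funext hefix
  -- The second integration by parts, done without boundary terms: `g₁` is bounded since its
  -- derivative is integrable, so each side is the unique bounded solution of the same first-order
  -- equation.
  have he₀₁' : ∀ s, e₀₁ s
      = (g₁ s + (fwdIntegral u γ r₂ s - bwdIntegral u γ r₂ s) / 2) / u ^ 2 := by
    obtain ⟨C₁, hC₁⟩ := exists_norm_le_of_hasDerivAt hr₂I hg₁ hgd₁
    intro s
    have h1 := hγ.eq_bwdIntegral_of_bounded hr₂I hr₂c (y := fun s => g₁ s - u * bwdIntegral u γ r s)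
      (hg₁.sub (continuous_const.mul hbc)) (fun s hs => by
        refine ((hgd₁ s hs).sub ((hγ.hasDerivAt_bwdIntegral hrI hs (hrc s hs)).const_mul u)
          ).congr_deriv ?_
        simp only [hr, hr₂]; ring) (C := C₁ + ‖u‖ * ∫ t, ‖r t‖) (fun s => by
        refine (norm_sub_le _ _).trans (add_le_add (hC₁ s) ?_)
        rw [norm_mul]
        exact mul_le_mul_of_nonneg_left (hγ.norm_bwdIntegral_le_integral hrI s) (norm_nonneg _)) s
    have h2 := hγ.eq_fwdIntegral_of_bounded hr₂I hr₂c (y := fun s => u * fwdIntegral u γ r s - g₁ s)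
      ((continuous_const.mul hfc).sub hg₁) (fun s hs => by
        refine (((hγ.hasDerivAt_fwdIntegral hrI hs (hrc s hs)).const_mul u).sub (hgd₁ s hs)
          ).congr_deriv ?_
        simp only [hr, hr₂]; ring) (C := ‖u‖ * (∫ t, ‖r t‖) + C₁) (fun s => by
        refine (norm_sub_le _ _).trans (add_le_add ?_ (hC₁ s))
        rw [norm_mul]
        exact mul_le_mul_of_nonneg_left (hγ.norm_fwdIntegral_le_integral hrI s) (norm_nonneg _)) s
    simp only [he₀₁]
    rw [← h1, ← h2]
    field_simp
    ring
  -- On differentiating `e`, the sources `ρ` of the two integrals cancel, so `e₁` contains only the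
  -- difference of the integrals and no longer the factor `1 / u`.
  refine ⟨e, fun s => e₀₁ s + (bwdIntegral u γ ρ s - fwdIntegral u γ ρ s) / 2, hec,
    he₀₁c.add ((hbρ.sub hfρ).div_const _), fun s hs => ?_, fun s hs => ?_, fun s => ?_,
    fun s => ?_⟩
  · have hb := hγ.hasDerivAt_bwdIntegral hrI hs (hrc s hs)
    have hf := hγ.hasDerivAt_fwdIntegral hrI hs (hrc s hs)
    have hb' := hγ.hasDerivAt_bwdIntegral hρI hs (hρc s hs)
    have hf' := hγ.hasDerivAt_fwdIntegral hρI hs (hρc s hs)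
    have h := (((hgd s hs).sub ((hb.sub hf).div_const 2)).div_const (u ^ 2)).sub
      ((hf'.add hb').div_const (2 * u))
    rw [hefun]
    refine h.congr_deriv ?_
    simp only [he₀₁, hr]
    field_simp
    ring
  · have hb := hγ.hasDerivAt_bwdIntegral hrI hs (hrc s hs)
    have hf := hγ.hasDerivAt_fwdIntegral hrI hs (hrc s hs)
    have hb' := hγ.hasDerivAt_bwdIntegral hρI hs (hρc s hs)
    have hf' := hγ.hasDerivAt_fwdIntegral hρI hs (hρc s hs)
    have h := ((hf.add hb).div_const (2 * u)).add ((hb'.sub hf').div_const 2)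
    refine h.congr_deriv ?_
    have h5 : u ^ 2 * e s = g s - (bwdIntegral u γ r s - fwdIntegral u γ r s) / 2
        - u * (fwdIntegral u γ ρ s + bwdIntegral u γ ρ s) / 2 := by
      rw [hefix s]; simp only [he₀]; field_simp
    rw [add_mul, h5]
    have h6 : ρ s = k s * deriv γ s * e s := rfl
    simp only [hr]
    field_simp
    linear_combination 2 * h6
  · rw [hefix s]
    refine (norm_sub_le _ _).trans (add_le_add (he₀n s) ?_)
    have h2 := norm_add_le (fwdIntegral u γ ρ s) (bwdIntegral u γ ρ s)
    rw [norm_div, norm_mul, Complex.norm_ofNat, div_le_iff₀ (by positivity)]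
    have h3 : L / (2 * ‖u‖ ^ 3) * (1 - 1 / (2 * ‖u‖) * I)⁻¹ * I * (2 * ‖u‖) = I * B := by
      rw [hBdef]
      generalize (1 - 1 / (2 * ‖u‖) * I)⁻¹ = q
      field_simp
    rw [h3]
    linarith [hρn s]
  · have h1 : ‖e₀₁ s‖ ≤ 1 / ‖u‖ ^ 2 * (‖g₁ s‖ + 1 / 2 * I₂) := by
      have h1 := hγ.norm_bwdIntegral_add_norm_fwdIntegral_le hr₂I s
      have h2 := norm_sub_le (fwdIntegral u γ r₂ s) (bwdIntegral u γ r₂ s)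
      have h3 := norm_add_le (g₁ s) ((fwdIntegral u γ r₂ s - bwdIntegral u γ r₂ s) / 2)
      rw [norm_div _ (2 : ℂ), Complex.norm_ofNat] at h3
      rw [he₀₁', norm_div, norm_pow, div_eq_inv_mul, one_div]
      refine mul_le_mul_of_nonneg_left ?_ (by positivity)
      linarith
    have h2 : ‖(bwdIntegral u γ ρ s - fwdIntegral u γ ρ s) / 2‖ ≤ 1 / ‖u‖ ^ 2 *
        (1 / 2 * L * (1 - 1 / (2 * ‖u‖) * I)⁻¹ * I) := by
      have h3 := norm_sub_le (bwdIntegral u γ ρ s) (fwdIntegral u γ ρ s)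
      rw [norm_div, Complex.norm_ofNat]
      have h4 : 1 / ‖u‖ ^ 2 * (1 / 2 * L * (1 - 1 / (2 * ‖u‖) * I)⁻¹ * I) = I * B / 2 := by
        rw [hBdef]; ring
      rw [h4]
      linarith [hρn s]
    refine (norm_add_le _ _).trans ((add_le_add h1 h2).trans_eq ?_)
    ring

end IsMonotonePath

/-! ### The Liouville transformation -/

/-- Analyticity on `D` makes the order of `f` nonnegative, and away from `z₀` it is at most zero;
order zero means a nonzero value. -/
theorem IsLiouvilleBranch.f_ne_zero {Z : Set ℂ} {z₀ : ℂ} {f g p : ℂ → ℂ}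
    (hZ : IsTurningPointEquation Z z₀ f g p) {D : Set ℂ} {ξ q : ℂ → ℂ}
    (hD : IsLiouvilleBranch Z z₀ f g D ξ q) {z : ℂ} (hz : z ∈ D) : f z ≠ 0 := by
  intro h0
  have ha := hD.analytic_f z hz
  have h1 := hZ.no_other_zero z (hD.subset hz).1 (hD.subset hz).2
  have h2 : analyticOrderAt f z ≠ 0 := fun h => (ha.analyticOrderAt_eq_zero.1 h) h0
  rw [ha.meromorphicOrderAt_eq] at h1
  cases h : analyticOrderAt f z with
  | top => simp [h] at h1
  | coe m =>
    rw [h] at h1 h2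
    have h3 : ((m : ℤ) : WithTop ℤ) ≤ 0 := by simpa using h1
    have h4 : (m : ℤ) ≤ 0 := by exact_mod_cast h3
    exact h2 (by exact_mod_cast (by omega : m = 0))

/-- The properties of a Liouville transformation in use below: an injective change of variable `ξ`
on a simply connected domain, with `ξ'² = f = q⁴` free of zeros. -/
structure IsLiouvilleMap (f g : ℂ → ℂ) (D : Set ℂ) (ξ q : ℂ → ℂ) : Prop where
  isOpen : IsOpen D
  isSimplyConnected : IsSimplyConnected D
  differentiableOn_f : DifferentiableOn ℂ f D
  differentiableOn_g : DifferentiableOn ℂ g D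
  differentiableOn_xi : DifferentiableOn ℂ ξ D
  deriv_xi_sq : ∀ z ∈ D, (deriv ξ z) ^ 2 = f z
  injOn_xi : InjOn ξ D
  differentiableOn_q : DifferentiableOn ℂ q D
  q_pow_four : ∀ z ∈ D, q z ^ 4 = f z
  f_ne_zero : ∀ z ∈ D, f z ≠ 0

theorem IsLiouvilleBranch.isLiouvilleMap {Z : Set ℂ} {z₀ : ℂ} {f g p : ℂ → ℂ}
    (hZ : IsTurningPointEquation Z z₀ f g p) {D : Set ℂ} {ξ q : ℂ → ℂ}
    (hD : IsLiouvilleBranch Z z₀ f g D ξ q) : IsLiouvilleMap f g D ξ q where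
  isOpen := hD.isOpen
  isSimplyConnected := hD.isSimplyConnected
  differentiableOn_f := hD.analytic_f.differentiableOn
  differentiableOn_g := hD.analytic_g.differentiableOn
  differentiableOn_xi := hD.differentiableOn_xi
  deriv_xi_sq := hD.deriv_xi_sq
  injOn_xi := hD.injOn_xi
  differentiableOn_q := hD.differentiableOn_q
  q_pow_four := hD.q_pow_four
  f_ne_zero := fun _ hz => hD.f_ne_zero hZ hz

/-- The transformed solution `f^{1/4} w` as a function of `ξ`. -/
def lgTransform (D : Set ℂ) (ξ q w : ℂ → ℂ) (t : ℂ) : ℂ := q (zOfXi D ξ t) * w (zOfXi D ξ t)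

theorem eqOn_deriv_sub {Ω : Set ℂ} (hΩ : IsOpen Ω) {a b : ℂ → ℂ}
    (ha : DifferentiableOn ℂ a Ω) (hb : DifferentiableOn ℂ b Ω) :
    EqOn (deriv fun t => a t - b t) (fun t => deriv a t - deriv b t) Ω := fun _ ht =>
  deriv_fun_sub (ha.differentiableAt (hΩ.mem_nhds ht)) (hb.differentiableAt (hΩ.mem_nhds ht))

theorem deriv_deriv_sub_of_differentiableOn {Ω : Set ℂ} (hΩ : IsOpen Ω) {a b : ℂ → ℂ}
    (ha : DifferentiableOn ℂ a Ω) (hb : DifferentiableOn ℂ b Ω) {t : ℂ} (ht : t ∈ Ω) :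
    deriv (deriv fun t => a t - b t) t = deriv (deriv a) t - deriv (deriv b) t := by
  rw [((eqOn_deriv_sub hΩ ha hb).eventuallyEq_of_mem (hΩ.mem_nhds ht)).deriv_eq]
  exact eqOn_deriv_sub hΩ (ha.deriv hΩ) (hb.deriv hΩ) ht

namespace IsLiouvilleMap

variable {f g p : ℂ → ℂ} {D : Set ℂ} {ξ q : ℂ → ℂ} (hD : IsLiouvilleMap f g D ξ q)
include hD

theorem q_ne_zero {z : ℂ} (hz : z ∈ D) : q z ≠ 0 := fun h =>
  hD.f_ne_zero z hz (by rw [← hD.q_pow_four z hz, h]; simp)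

theorem deriv_xi_ne_zero {z : ℂ} (hz : z ∈ D) : deriv ξ z ≠ 0 := fun h =>
  hD.f_ne_zero z hz (by rw [← hD.deriv_xi_sq z hz, h]; simp)

theorem zOfXi_xi {z : ℂ} (hz : z ∈ D) : zOfXi D ξ (ξ z) = z :=
  hD.injOn_xi.leftInvOn_invFunOn hz

theorem hasStrictDerivAt_xi {z : ℂ} (hz : z ∈ D) : HasStrictDerivAt ξ (deriv ξ z) z :=
  (hD.differentiableOn_xi.analyticAt (hD.isOpen.mem_nhds hz)).hasStrictDerivAt

theorem isOpen_image : IsOpen (ξ '' D) := by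
  rw [isOpen_iff_mem_nhds]
  rintro _ ⟨z, hz, rfl⟩
  rw [← (hD.hasStrictDerivAt_xi hz).map_nhds_eq (hD.deriv_xi_ne_zero hz)]
  exact image_mem_map (hD.isOpen.mem_nhds hz)

theorem hasDerivAt_zOfXi {z : ℂ} (hz : z ∈ D) :
    HasDerivAt (zOfXi D ξ) (deriv ξ z)⁻¹ (ξ z) := by
  have hs := hD.hasStrictDerivAt_xi hz
  have hne := hD.deriv_xi_ne_zero hz
  -- By injectivity the global inverse agrees near `ξ z` with the local inverse from the inverse
  -- function theorem.
  refine (hs.to_localInverse hne).hasDerivAt.congr_of_eventuallyEq ?_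
  have hc : ContinuousAt (hs.localInverse ξ _ z hne) (ξ z) :=
    (hs.to_localInverse hne).hasDerivAt.continuousAt
  have hv : hs.localInverse ξ _ z hne (ξ z) = z := HasStrictFDerivAt.localInverse_apply_image ..
  have h1 : ∀ᶠ t in 𝓝 (ξ z), hs.localInverse ξ _ z hne t ∈ D :=
    hc.eventually (by rw [hv]; exact hD.isOpen.mem_nhds hz)
  have h2 : ∀ᶠ t in 𝓝 (ξ z), ξ (hs.localInverse ξ _ z hne t) = t :=
    HasStrictFDerivAt.eventually_right_inverse ..
  filter_upwards [h1, h2] with t ht1 ht2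
  have := hD.zOfXi_xi ht1
  rwa [ht2] at this

theorem hasDerivAt_comp_zOfXi {v : ℂ → ℂ} {v' z : ℂ} (hz : z ∈ D) (hv : HasDerivAt v v' z) :
    HasDerivAt (fun t => v (zOfXi D ξ t)) (v' / deriv ξ z) (ξ z) := by
  rw [div_eq_mul_inv]
  refine HasDerivAt.comp (h₂ := v) (ξ z) ?_ (hD.hasDerivAt_zOfXi hz)
  rwa [hD.zOfXi_xi hz]

theorem differentiableOn_comp_zOfXi {v : ℂ → ℂ} (hv : DifferentiableOn ℂ v D) :
    DifferentiableOn ℂ (fun t => v (zOfXi D ξ t)) (ξ '' D) := by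
  rintro _ ⟨z, hz, rfl⟩
  exact (hD.hasDerivAt_comp_zOfXi hz (hv.differentiableAt
    (hD.isOpen.mem_nhds hz)).hasDerivAt).differentiableAt.differentiableWithinAt

theorem differentiableOn_lgPhi : DifferentiableOn ℂ (lgPhi f g) D := by
  have hf := hD.differentiableOn_f
  have hf' := hf.deriv hD.isOpen
  have hf'' := hf'.deriv hD.isOpen
  refine DifferentiableOn.add (DifferentiableOn.div ?_ ?_ fun z hz => ?_)
    (hD.differentiableOn_g.div hf hD.f_ne_zero)
  · exact ((hf.const_mul 4).mul hf'').sub ((hf'.pow 2).const_mul 5)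
  · exact (hf.pow 3).const_mul 16
  · simpa using hD.f_ne_zero z hz

theorem differentiableOn_lgPsi : DifferentiableOn ℂ (lgPsi f g D ξ) (ξ '' D) :=
  hD.differentiableOn_comp_zOfXi hD.differentiableOn_lgPhi

theorem differentiableOn_lgCoeff (hp : DifferentiableOn ℂ p D) (n : ℕ) :
    DifferentiableOn ℂ (lgCoeff f g p D ξ q n) (ξ '' D) := by
  induction n with
  | zero =>
    refine hD.differentiableOn_comp_zOfXi (v := fun z => -(p z / q z ^ 3)) ?_
    exact (hp.div (hD.differentiableOn_q.pow 3) fun z hz => pow_ne_zero 3 (hD.q_ne_zero hz)).neg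
  | succ n ih =>
    exact ((ih.deriv hD.isOpen_image).deriv hD.isOpen_image).sub (hD.differentiableOn_lgPsi.mul ih)

/-- `Φ` in terms of the fourth root `q` of `f`. -/
theorem lgPhi_eq {z : ℂ} (hz : z ∈ D) :
    lgPhi f g z = (deriv (deriv q) z * q z - 2 * (deriv q z) ^ 2) / q z ^ 6 + g z / f z := by
  have hq := hD.differentiableOn_q
  have hd : ∀ y ∈ D, HasDerivAt q (deriv q y) y := fun y hy =>
    (hq.differentiableAt (hD.isOpen.mem_nhds hy)).hasDerivAt
  have hd' : HasDerivAt (deriv q) (deriv (deriv q) z) z :=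
    ((hq.deriv hD.isOpen).differentiableAt (hD.isOpen.mem_nhds hz)).hasDerivAt
  have hf1 : ∀ y ∈ D, deriv f y = 4 * q y ^ 3 * deriv q y := by
    intro y hy
    have : f =ᶠ[𝓝 y] fun x => q x ^ 4 := by
      filter_upwards [hD.isOpen.mem_nhds hy] with x hx using (hD.q_pow_four x hx).symm
    rw [this.deriv_eq, ((hd y hy).fun_pow 4).deriv]
    norm_num
  have hf2 : deriv (deriv f) z = 12 * q z ^ 2 * (deriv q z) ^ 2
      + 4 * q z ^ 3 * deriv (deriv q) z := by
    have : deriv f =ᶠ[𝓝 z] fun y => 4 * q y ^ 3 * deriv q y := by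
      filter_upwards [hD.isOpen.mem_nhds hz] with y hy using hf1 y hy
    rw [this.deriv_eq, ((((hd z hz).fun_pow 3).const_mul 4).fun_mul hd').deriv]
    norm_num
    ring
  have hq0 := hD.q_ne_zero hz
  rw [lgPhi, hf1 z hz, hf2, ← hD.q_pow_four z hz]
  congr 1
  field_simp
  ring

/-- Differentiating ξ'² = q⁴ leaves open which of ±q² equals ξ'; the two branches need not be
compatible. -/
theorem deriv_deriv_xi {z : ℂ} (hz : z ∈ D) :
    deriv (deriv ξ) z * deriv ξ z = 2 * q z ^ 3 * deriv q z := by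
  have hq := (hD.differentiableOn_q.differentiableAt (hD.isOpen.mem_nhds hz)).hasDerivAt
  have hx := ((hD.differentiableOn_xi.deriv hD.isOpen).differentiableAt
    (hD.isOpen.mem_nhds hz)).hasDerivAt
  have he : (fun y => deriv ξ y ^ 2) =ᶠ[𝓝 z] fun y => q y ^ 4 := by
    filter_upwards [hD.isOpen.mem_nhds hz] with y hy
    rw [hD.deriv_xi_sq y hy, hD.q_pow_four y hy]
  have := (hx.fun_pow 2).unique ((hq.fun_pow 4).congr_of_eventuallyEq he)
  norm_num at this
  linear_combination this / 2

variable {u : ℂ} {w : ℂ → ℂ}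

theorem differentiableOn_lgTransform (hw : DifferentiableOn ℂ w D) :
    DifferentiableOn ℂ (lgTransform D ξ q w) (ξ '' D) :=
  hD.differentiableOn_comp_zOfXi (v := fun z => q z * w z) (hD.differentiableOn_q.mul hw)

theorem deriv_lgTransform (hw : DifferentiableOn ℂ w D) {z : ℂ} (hz : z ∈ D) :
    deriv (lgTransform D ξ q w) (ξ z) = (deriv q z * w z + q z * deriv w z) / deriv ξ z :=
  (hD.hasDerivAt_comp_zOfXi (v := fun z => q z * w z) hz
    ((hD.differentiableOn_q.differentiableAt (hD.isOpen.mem_nhds hz)).hasDerivAt.mul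
      (hw.differentiableAt (hD.isOpen.mem_nhds hz)).hasDerivAt)).deriv

/-- The Liouville transformation brings the equation to the form `W'' = (u² + ψ) W - G₀`. -/
theorem deriv_deriv_lgTransform (hw : IsParticularSolution f g p u D w) {t : ℂ} (ht : t ∈ ξ '' D) :
    deriv (deriv (lgTransform D ξ q w)) t
      = (u ^ 2 + lgPsi f g D ξ t) * lgTransform D ξ q w t - lgCoeff f g p D ξ q 0 t := by
  obtain ⟨z, hz, rfl⟩ := ht
  have hn := hD.isOpen.mem_nhds hz
  have he : deriv (lgTransform D ξ q w) =ᶠ[𝓝 (ξ z)] fun t =>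
      (fun z => (deriv q z * w z + q z * deriv w z) / deriv ξ z) (zOfXi D ξ t) := by
    filter_upwards [hD.isOpen_image.mem_nhds (mem_image_of_mem ξ hz)]
    rintro _ ⟨y, hy, rfl⟩
    simp only [hD.zOfXi_xi hy, hD.deriv_lgTransform hw.1 hy]
  have hq := (hD.differentiableOn_q.differentiableAt hn).hasDerivAt
  have hq' := ((hD.differentiableOn_q.deriv hD.isOpen).differentiableAt hn).hasDerivAt
  have hw0 := (hw.1.differentiableAt hn).hasDerivAt
  have hw' := ((hw.1.deriv hD.isOpen).differentiableAt hn).hasDerivAt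
  have hx' := ((hD.differentiableOn_xi.deriv hD.isOpen).differentiableAt hn).hasDerivAt
  have hX := hD.deriv_xi_ne_zero hz
  rw [he.deriv_eq, (hD.hasDerivAt_comp_zOfXi hz
    (((hq'.fun_mul hw0).fun_add (hq.fun_mul hw')).fun_div hx' hX)).deriv]
  have hq0 := hD.q_ne_zero hz
  simp only [lgTransform, lgPsi, lgCoeff, hD.zOfXi_xi hz, hD.lgPhi_eq hz]
  have hode : deriv (deriv w) z = (u ^ 2 * f z + g z) * w z + p z := by
    linear_combination hw.2 z hz
  have hX2 : deriv ξ z ^ 2 = q z ^ 4 := by rw [hD.deriv_xi_sq z hz, hD.q_pow_four z hz]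
  have hxx : deriv (deriv ξ) z = 2 * q z ^ 3 * deriv q z / deriv ξ z := by
    rw [eq_div_iff hX]; exact hD.deriv_deriv_xi hz
  rw [hode, hxx, ← hD.q_pow_four z hz]
  generalize deriv ξ z = X at *
  field_simp
  -- Only even powers of ξ' remain, so its sign relative to q² never enters.
  have hX4 : X ^ 4 = q z ^ 8 := by linear_combination (X ^ 2 + q z ^ 4) * hX2
  simp only [hX2]
  field_simp
  linear_combination -(q z * deriv (deriv q) z * w z + q z ^ 2 * w z * g z + q z ^ 2 * p z
    + q z ^ 6 * w z * u ^ 2 - 2 * w z * deriv q z ^ 2) * hX4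

theorem differentiableOn_lgError (hp : DifferentiableOn ℂ p D) (hw : DifferentiableOn ℂ w D)
    (n : ℕ) : DifferentiableOn ℂ (lgError f g p D ξ q u n w) (ξ '' D) := by
  refine (hD.differentiableOn_lgTransform hw).sub (DifferentiableOn.const_mul ?_ _)
  exact DifferentiableOn.fun_sum fun s _ => (hD.differentiableOn_lgCoeff hp s).div_const _

/-- The differential equation of the error term. -/
theorem deriv_deriv_lgError (hu : u ≠ 0) (hp : DifferentiableOn ℂ p D)
    (hw : IsParticularSolution f g p u D w) (n : ℕ) {t : ℂ} (ht : t ∈ ξ '' D) :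
    deriv (deriv (lgError f g p D ξ q u n w)) t
      = (u ^ 2 + lgPsi f g D ξ t) * lgError f g p D ξ q u n w t
        - lgCoeff f g p D ξ q n t / u ^ (2 * n) := by
  induction n generalizing t with
  | zero =>
    have : lgError f g p D ξ q u 0 w = lgTransform D ξ q w := by
      ext t; simp [lgError, lgTransform]
    rw [this, hD.deriv_deriv_lgTransform hw ht]
    simp
  | succ n ih =>
    -- Here u² times the subtracted term cancels `G_n / u^(2n)`, and its second derivative and
    -- ψ-term combine to `G_{n+1} / u^(2n+2)`.
    have he : lgError f g p D ξ q u (n + 1) w = fun t => lgError f g p D ξ q u n w t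
        - 1 / u ^ (2 * n + 2) * lgCoeff f g p D ξ q n t := by
      ext t
      simp only [lgError, Finset.sum_range_succ]
      field_simp
      ring
    have hG := hD.differentiableOn_lgCoeff hp n
    rw [he, deriv_deriv_sub_of_differentiableOn hD.isOpen_image
      (hD.differentiableOn_lgError hp hw.1 n) (hG.const_mul _) ht, ih ht]
    have h1 : deriv (deriv fun t => 1 / u ^ (2 * n + 2) * lgCoeff f g p D ξ q n t) t
        = 1 / u ^ (2 * n + 2) * deriv (deriv (lgCoeff f g p D ξ q n)) t := by
      simp only [deriv_const_mul_field']
    rw [h1]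
    simp only [lgCoeff]
    field_simp
    ring

/-- There is a particular solution with arbitrary initial data in the variable `ξ`. -/
theorem exists_isParticularSolution (hp : DifferentiableOn ℂ p D) {t : ℂ} (ht : t ∈ ξ '' D)
    (u a b : ℂ) : ∃ w, IsParticularSolution f g p u D w ∧ lgTransform D ξ q w t = a ∧
      deriv (lgTransform D ξ q w) t = b := by
  obtain ⟨z, hz, rfl⟩ := ht
  have hq0 := hD.q_ne_zero hz
  -- The initial values solve q w = a and (q' w + q w') / ξ' = b for w and w' at `z`.
  obtain ⟨w, hw, hw0, hw1, hode⟩ := exists_deriv_deriv_eq hD.isOpen hD.isSimplyConnected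
    (A := fun z => u ^ 2 * f z + g z) (h := p)
    ((hD.differentiableOn_f.const_mul _).add hD.differentiableOn_g) hp hz
    (a / q z) ((b * deriv ξ z - deriv q z * (a / q z)) / q z)
  refine ⟨w, ⟨hw, fun y hy => by rw [hode y hy]; ring⟩, ?_, ?_⟩
  · rw [lgTransform, hD.zOfXi_xi hz, hw0]
    field_simp
  · rw [hD.deriv_lgTransform hw hz, hw0, hw1]
    have := hD.deriv_xi_ne_zero hz
    field_simp
    ring

end IsLiouvilleMap

/-! ### Passage between the path and the domain -/

namespace IsMonotonePath

variable {u : ℂ} {γ : ℝ → ℂ} {S : Finset ℝ} (hγ : IsMonotonePath u γ S) {Ω : Set ℂ}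
  (hΩ : IsOpen Ω) (hm : ∀ s, γ s ∈ Ω) {F : ℂ → ℂ} (hF : DifferentiableOn ℂ F Ω)
include hγ hm hF

theorem continuous_comp : Continuous fun s => F (γ s) :=
  hF.continuousOn.comp_continuous hγ.continuous hm

include hΩ

theorem hasDerivAt_comp {s : ℝ} (hs : s ∉ S) :
    HasDerivAt (fun s => F (γ s)) (deriv F (γ s) * deriv γ s) s :=
  ((hF.differentiableAt (hΩ.mem_nhds (hm s))).hasDerivAt).comp s (hγ.hasDerivAt s hs)

/-- A function holomorphic on a domain that vanishes on a path in it vanishes on the domain. -/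
theorem eqOn_zero_of_preconnected (hc : IsPreconnected Ω) (h0 : ∀ s, F (γ s) = 0) :
    EqOn F 0 Ω := by
  -- Away from the junctions γ' ≠ 0, so nearby points of the path differ from `γ s` and the zeros
  -- accumulate there.
  obtain ⟨s, hs⟩ := S.exists_notMem
  refine (hF.analyticOnNhd hΩ).eqOn_zero_of_preconnected_of_frequently_eq_zero hc (hm s) ?_
  have h1 : Tendsto γ (𝓝[≠] s) (𝓝[≠] γ s) :=
    tendsto_nhdsWithin_iff.2 ⟨hγ.continuous.continuousAt.tendsto.mono_left nhdsWithin_le_nhds,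
      (hγ.hasDerivAt s hs).eventually_ne (hγ.deriv_ne_zero s hs)⟩
  exact h1.frequently (Eventually.of_forall h0).frequently

end IsMonotonePath

namespace IsLiouvilleMap

variable {f g p : ℂ → ℂ} {D : Set ℂ} {ξ q : ℂ → ℂ} (hD : IsLiouvilleMap f g D ξ q)
include hD

theorem isParticularSolution_sub {u : ℂ} {w w' : ℂ → ℂ} (hw : IsParticularSolution f g p u D w)
    (hw' : IsParticularSolution f g p u D w') :
    IsParticularSolution f g 0 u D fun z => w z - w' z := by
  refine ⟨hw.1.sub hw'.1, fun z hz => ?_⟩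
  rw [deriv_deriv_sub_of_differentiableOn hD.isOpen hw.1 hw'.1 hz, Pi.zero_apply]
  linear_combination hw.2 z hz - hw'.2 z hz

/-- The transformed homogeneous equation. -/
theorem deriv_deriv_lgTransform_homogeneous {u : ℂ} {y : ℂ → ℂ}
    (hy : IsParticularSolution f g 0 u D y) {t : ℂ} (ht : t ∈ ξ '' D) :
    deriv (deriv (lgTransform D ξ q y)) t
      = (u ^ 2 + lgPsi f g D ξ t) * lgTransform D ξ q y t := by
  rw [hD.deriv_deriv_lgTransform hy ht]
  simp [lgCoeff]

variable {u : ℂ} {γ : ℝ → ℂ} {S : Finset ℝ} (hγ : IsMonotonePath u γ S)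
  (hm : ∀ s, γ s ∈ ξ '' D)
include hγ hm

/-- Uniqueness for the initial value problem along the path. -/
theorem eq_zero_of_initial {d d₁ : ℝ → ℂ} (hd : Continuous d) (hd₁ : Continuous d₁)
    (hdd : ∀ s ∉ S, HasDerivAt d (d₁ s * deriv γ s) s)
    (hdd₁ : ∀ s ∉ S, HasDerivAt d₁ ((u ^ 2 + lgPsi f g D ξ (γ s)) * d s * deriv γ s) s)
    (h0 : d 0 = 0) (h0₁ : d₁ 0 = 0) (s : ℝ) : d s = 0 ∧ d₁ s = 0 := by
  -- The Wronskian of `d` with a holomorphic homogeneous solution is constant along the path and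
  -- zero at `0`. That solution may have any data at `γ s`, which forces `d s = d₁ s = 0`.
  have key : ∀ a b : ℂ, d s * b - d₁ s * a = 0 := by
    intro a b
    obtain ⟨y, hy, rfl, rfl⟩ := hD.exists_isParticularSolution (p := 0)
      (differentiableOn_const _) (hm s) u a b
    have hYd := hD.differentiableOn_lgTransform hy.1
    have hYd' := hYd.deriv hD.isOpen_image
    have := eq_of_hasDerivAt_zero_off_finset (S := S)
      (f := fun s => d s * deriv (lgTransform D ξ q y) (γ s) - d₁ s * lgTransform D ξ q y (γ s))
      ((hd.mul (hγ.continuous_comp hm hYd')).sub (hd₁.mul (hγ.continuous_comp hm hYd)))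
      (fun s hs => by
        refine (((hdd s hs).mul (hγ.hasDerivAt_comp hD.isOpen_image hm hYd' hs)).sub
          ((hdd₁ s hs).mul (hγ.hasDerivAt_comp hD.isOpen_image hm hYd hs))).congr_deriv ?_
        rw [hD.deriv_deriv_lgTransform_homogeneous hy (hm s)]
        ring) s 0
    simpa [h0, h0₁] using this
  exact ⟨by simpa using key 0 1, by simpa using key 1 0⟩

/-- Two solutions whose error terms are bounded on the path coincide. -/
theorem eqOn_of_bddAbove_lgError (hψ : PathIntegrable γ (lgPsi f g D ξ))
    (hu : 1 / 2 * pathIntegral γ (lgPsi f g D ξ) < ‖u‖) {n : ℕ} {w w' : ℂ → ℂ}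
    (hw : IsParticularSolution f g p u D w) (hw' : IsParticularSolution f g p u D w')
    (hb : BddAbove (range fun s => ‖lgError f g p D ξ q u n w (γ s)‖))
    (hb' : BddAbove (range fun s => ‖lgError f g p D ξ q u n w' (γ s)‖)) : EqOn w' w D := by
  have hv := hD.isParticularSolution_sub hw' hw
  have hV := hD.differentiableOn_lgTransform hv.1
  have hV' := hV.deriv hD.isOpen_image
  obtain ⟨B, hB⟩ := hb
  obtain ⟨B', hB'⟩ := hb'
  have h0 := hγ.eq_zero_of_bounded (hγ.continuous_comp hm hD.differentiableOn_lgPsi) hψ hu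
    (hγ.continuous_comp hm hV) (hγ.continuous_comp hm hV')
    (fun s hs => hγ.hasDerivAt_comp hD.isOpen_image hm hV hs)
    (fun s hs => by
      rw [← hD.deriv_deriv_lgTransform_homogeneous hv (hm s)]
      exact hγ.hasDerivAt_comp hD.isOpen_image hm hV' hs)
    ⟨B' + B, by
      rintro _ ⟨s, rfl⟩
      -- The subtracted sums do not depend on the solution, so they drop out of the difference.
      have e : lgTransform D ξ q (fun z => w' z - w z) (γ s)
          = lgError f g p D ξ q u n w' (γ s) - lgError f g p D ξ q u n w (γ s) := by
        simp only [lgTransform, lgError]; ring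
      simp only [e]
      exact (norm_sub_le _ _).trans (add_le_add (hB' ⟨s, rfl⟩) (hB ⟨s, rfl⟩))⟩
  have hconn : IsPreconnected (ξ '' D) :=
    hD.isSimplyConnected.isPathConnected.isConnected.isPreconnected.image ξ
      hD.differentiableOn_xi.continuousOn
  have h1 := hγ.eqOn_zero_of_preconnected hD.isOpen_image hm hV hconn h0
  intro z hz
  have h2 := h1 (mem_image_of_mem ξ hz)
  rw [lgTransform, hD.zOfXi_xi hz, Pi.zero_apply, mul_eq_zero] at h2
  exact sub_eq_zero.1 (h2.resolve_left (hD.q_ne_zero hz))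

/-- There is a solution whose error term and its derivative satisfy the bounds on the path. -/
theorem exists_lgError_le (hp : DifferentiableOn ℂ p D) (n : ℕ)
    (hψ : PathIntegrable γ (lgPsi f g D ξ))
    (hu : 1 / 2 * pathIntegral γ (lgPsi f g D ξ) < ‖u‖)
    (hG : BddAbove (range fun s : ℝ => ‖lgCoeff f g p D ξ q n (γ s)‖))
    (hG' : PathIntegrable γ (deriv (lgCoeff f g p D ξ q n)))
    (hG'' : PathIntegrable γ (deriv (deriv (lgCoeff f g p D ξ q n)))) :
    ∃ w : ℂ → ℂ, IsParticularSolution f g p u D w ∧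
      (∀ s, ‖lgError f g p D ξ q u n w (γ s)‖ ≤
        1 / ‖u‖ ^ (2 * n + 2) * (‖lgCoeff f g p D ξ q n (γ s)‖
            + 1 / 2 * pathIntegral γ (deriv (lgCoeff f g p D ξ q n)))
          + lgL γ (lgCoeff f g p D ξ q n) / (2 * ‖u‖ ^ (2 * n + 3))
            * (1 - 1 / (2 * ‖u‖) * pathIntegral γ (lgPsi f g D ξ))⁻¹
            * pathIntegral γ (lgPsi f g D ξ)) ∧
      (∀ s, ‖deriv (lgError f g p D ξ q u n w) (γ s)‖ ≤
        1 / ‖u‖ ^ (2 * n + 2) * (‖deriv (lgCoeff f g p D ξ q n) (γ s)‖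
          + 1 / 2 * pathIntegral γ (deriv (deriv (lgCoeff f g p D ξ q n)))
          + 1 / 2 * lgL γ (lgCoeff f g p D ξ q n)
            * (1 - 1 / (2 * ‖u‖) * pathIntegral γ (lgPsi f g D ξ))⁻¹
            * pathIntegral γ (lgPsi f g D ξ))) := by
  have hu0 : 0 < ‖u‖ := by
    refine lt_of_le_of_lt (mul_nonneg (by norm_num) (integral_nonneg fun s => ?_)) hu
    positivity
  have hune : u ≠ 0 := norm_pos_iff.1 hu0
  have hΞ := hD.isOpen_image
  have hGd := hD.differentiableOn_lgCoeff hp n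
  have hGd' := hGd.deriv hΞ
  have hGd'' := hGd'.deriv hΞ
  obtain ⟨e, e₁, hec, he₁c, hed, hed₁, heb, he₁b⟩ := hγ.exists_solution_with_bounds
    (hγ.continuous_comp hm hD.differentiableOn_lgPsi) hψ hu (hγ.continuous_comp hm hGd)
    (hγ.continuous_comp hm hGd') (hγ.continuous_comp hm hGd'')
    (fun s hs => hγ.hasDerivAt_comp hΞ hm hGd hs)
    (fun s hs => hγ.hasDerivAt_comp hΞ hm hGd' hs) hG hG' hG''
  set P : ℂ → ℂ := fun t =>
    1 / u ^ 2 * ∑ s ∈ Finset.range n, lgCoeff f g p D ξ q s t / u ^ (2 * s) with hP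
  have hPd : DifferentiableOn ℂ P (ξ '' D) := DifferentiableOn.const_mul
    (DifferentiableOn.fun_sum fun s _ => (hD.differentiableOn_lgCoeff hp s).div_const _) _
  -- The path solution `e` has source `G_n` rather than `G_n / u^(2n)`, so the error term should be
  -- `e / u^(2n)`; adding back `P` gives the data for the transformed solution at `γ 0`.
  obtain ⟨w, hw, hw0, hw1⟩ := hD.exists_isParticularSolution hp (hm 0) u
    (e 0 / u ^ (2 * n) + P (γ 0)) (e₁ 0 / u ^ (2 * n) + deriv P (γ 0))
  have hε := hD.differentiableOn_lgError (u := u) hp hw.1 n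
  have hε' := hε.deriv hΞ
  have hε0 : lgError f g p D ξ q u n w (γ 0) = e 0 / u ^ (2 * n) := by
    change lgTransform D ξ q w (γ 0) - P (γ 0) = _
    rw [hw0]; ring
  have hε0' : deriv (lgError f g p D ξ q u n w) (γ 0) = e₁ 0 / u ^ (2 * n) := by
    have := eqOn_deriv_sub hΞ (hD.differentiableOn_lgTransform hw.1) hPd (hm 0)
    exact this.trans (by simp only [hw1]; ring)
  have hmatch := fun s => hD.eq_zero_of_initial hγ hm
    (d := fun s => lgError f g p D ξ q u n w (γ s) - e s / u ^ (2 * n))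
    (d₁ := fun s => deriv (lgError f g p D ξ q u n w) (γ s) - e₁ s / u ^ (2 * n))
    ((hγ.continuous_comp hm hε).sub (hec.div_const _))
    ((hγ.continuous_comp hm hε').sub (he₁c.div_const _))
    (fun s hs => by
      refine ((hγ.hasDerivAt_comp hΞ hm hε hs).sub ((hed s hs).div_const _)).congr_deriv ?_
      ring)
    (fun s hs => by
      refine ((hγ.hasDerivAt_comp hΞ hm hε' hs).sub ((hed₁ s hs).div_const _)).congr_deriv ?_
      rw [hD.deriv_deriv_lgError hune hp hw n (hm s)]
      ring) (by simp [hε0]) (by simp [hε0']) s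
  refine ⟨w, hw, fun s => ?_, fun s => ?_⟩
  · rw [sub_eq_zero.1 (hmatch s).1, norm_div, norm_pow, div_le_iff₀ (by positivity)]
    refine (heb s).trans_eq ?_
    simp only [pathIntegral, lgL]
    generalize (1 - 1 / (2 * ‖u‖) * ∫ s, ‖lgPsi f g D ξ (γ s)‖ * ‖deriv γ s‖)⁻¹ = κ
    field_simp
    ring
  · rw [sub_eq_zero.1 (hmatch s).2, norm_div, norm_pow, div_le_iff₀ (by positivity)]
    refine (he₁b s).trans_eq ?_
    simp only [pathIntegral, lgL]
    generalize (1 - 1 / (2 * ‖u‖) * ∫ s, ‖lgPsi f g D ξ (γ s)‖ * ‖deriv γ s‖)⁻¹ = κ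
    field_simp
    ring

end IsLiouvilleMap

end

/-! ### The theorem -/

theorem mainTheorem4 (Z : Set ℂ) (z₀ : ℂ) (f g p : ℂ → ℂ)
    (hZ : IsTurningPointEquation Z z₀ f g p)
    (D : Set ℂ) (ξ q : ℂ → ℂ) (hD : IsLiouvilleBranch Z z₀ f g D ξ q)
    (u : ℂ) (γ : ℝ → ℂ) (hγ : IsProgressivePath u (ξ '' D) γ) (n : ℕ)
    (hψ : PathIntegrable γ (lgPsi f g D ξ))
    (hu : 1 / 2 * pathIntegral γ (lgPsi f g D ξ) < ‖u‖)
    (hG : BddAbove (Set.range fun s : ℝ => ‖lgCoeff f g p D ξ q n (γ s)‖))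
    (hG' : PathIntegrable γ (deriv (lgCoeff f g p D ξ q n)))
    (hG'' : PathIntegrable γ (deriv (deriv (lgCoeff f g p D ξ q n)))) :
    ∃ w : ℂ → ℂ, IsParticularSolution f g p u D w ∧
      -- the error bound that identifies the particular solution
      (∀ t ∈ Set.range γ, ‖lgError f g p D ξ q u n w t‖ ≤
        1 / ‖u‖ ^ (2 * n + 2) * (‖lgCoeff f g p D ξ q n t‖
            + 1 / 2 * pathIntegral γ (deriv (lgCoeff f g p D ξ q n)))
          + lgL γ (lgCoeff f g p D ξ q n) / (2 * ‖u‖ ^ (2 * n + 3))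
            * (1 - 1 / (2 * ‖u‖) * pathIntegral γ (lgPsi f g D ξ))⁻¹
            * pathIntegral γ (lgPsi f g D ξ)) ∧
      -- uniqueness, among all solutions whose error term is bounded on the path
      (∀ w' : ℂ → ℂ, IsParticularSolution f g p u D w' →
        BddAbove (Set.range fun s : ℝ => ‖lgError f g p D ξ q u n w' (γ s)‖) →
        Set.EqOn w' w D) ∧
      -- the bound for the derivative of the error term
      (∀ t ∈ Set.range γ, DifferentiableAt ℂ (lgError f g p D ξ q u n w) t ∧
        ‖deriv (lgError f g p D ξ q u n w) t‖ ≤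
          1 / ‖u‖ ^ (2 * n + 2) * (‖deriv (lgCoeff f g p D ξ q n) t‖
            + 1 / 2 * pathIntegral γ (deriv (deriv (lgCoeff f g p D ξ q n)))
            + 1 / 2 * lgL γ (lgCoeff f g p D ξ q n)
              * (1 - 1 / (2 * ‖u‖) * pathIntegral γ (lgPsi f g D ξ))⁻¹
              * pathIntegral γ (lgPsi f g D ξ))) := by

  have hM := hD.isLiouvilleMap hZ
  have hp : DifferentiableOn ℂ p D :=
    hZ.analytic_p.differentiableOn.mono fun z hz => (hD.subset hz).1
  obtain ⟨S, hS⟩ := hγ.exists_isMonotonePath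
  obtain ⟨w, hw, hle, hle'⟩ := hM.exists_lgError_le hS hγ.mem hp n hψ hu hG hG' hG''
  refine ⟨w, hw, ?_, fun w' hw' hb' => ?_, ?_⟩
  · rintro _ ⟨s, rfl⟩
    exact hle s
  -- With |G_n| ≤ B on the path, the error bound for `w` becomes uniform, so `w` itself has bounded
  -- error term and uniqueness applies.
  · obtain ⟨B, hB⟩ := hG
    refine hM.eqOn_of_bddAbove_lgError hS hγ.mem hψ hu hw hw'
      ⟨1 / ‖u‖ ^ (2 * n + 2) * (B + 1 / 2 * pathIntegral γ (deriv (lgCoeff f g p D ξ q n)))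
          + lgL γ (lgCoeff f g p D ξ q n) / (2 * ‖u‖ ^ (2 * n + 3))
            * (1 - 1 / (2 * ‖u‖) * pathIntegral γ (lgPsi f g D ξ))⁻¹
            * pathIntegral γ (lgPsi f g D ξ), ?_⟩ hb'
    rintro _ ⟨s, rfl⟩
    refine (hle s).trans ?_
    gcongr
    exact hB ⟨s, rfl⟩
  · rintro _ ⟨s, rfl⟩
    exact ⟨(hM.differentiableOn_lgError hp hw.1 n).differentiableAt
      (hM.isOpen_image.mem_nhds (hγ.mem s)), hle' s⟩
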